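/- Let $K$ be a nonarchimedean local field with ring of integers $\mathcal{O}_K$ and uniformizer $\pi_K$. An order in $\mathbb{M}_2(K)$ is a subring with $1$ that is a finitely generated $\mathcal{O}_K$-submodule; it is full if it spans $\mathbb{M}_2(K)$ over $K$, and a maximal order is a maximal element among the full orders. A two-sided fractional ideal of a full order $\mathfrak{R}$ is a finitely generated $\mathcal{O}_K$-submodule of $\mathbb{M}_2(K)$ that spans $\mathbb{M}_2(K)$ over $K$ and is stable under left and right multiplication by $\mathfrak{R}$. A full order $\mathfrak{R}$ is Gorenstein if its codifferent $C=\{a\in\mathbb{M}_2(K) : \mathrm{tr}(a\mathfrak{R})\subseteq\mathcal{O}_K\}$ is an invertible two-sided fractional $\mathfrak{R}$-ideal, i.e. $C$ is such an ideal and $CJ=JC=\mathfrak{R}$ for some two-sided fractional $\mathfrak{R}$-ideal $J$. An order $\mathfrak{H}$ is Bass if every full order containing $\mathfrak{H}$ is Gorenstein. (If $\mathfrak{H}$ is full, every order containing it is full.) The Bruhat–Tits tree $\mathfrak{t}(K)$ is the graph whose vertices are the maximal orders in $\mathbb{M}_2(K)$, where $\mathfrak{D}$ and $\mathfrak{D}'$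 are adjacent if, in some basis of $K^2$, they have the form $$\mathfrak{D}=\begin{pmatrix}\mathcal{O}_K&\mathcal{O}_K\\ \mathcal{O}_K&\mathcal{O}_K\end{pmatrix},\qquad \mathfrak{D}'=\begin{pmatrix}\mathcal{O}_K&\pi_K^{-1}\mathcal{O}_K\\ \pi_K\mathcal{O}_K&\mathcal{O}_K\end{pmatrix}.$$ The branch $\mathfrak{s}_K(\mathfrak{H})$ is the induced subgraph of $\mathfrak{t}(K)$ whose vertices are the maximal orders containing $\mathfrak{H}$. A line is a subgraph isomorphic to a non-empty connected induced subgraph of the graph with vertex set $\mathbb{Z}$ in which $m,n$ are adjacent when $|m-n|=1$ (so single vertices, finite paths, rays and two-sided infinite paths are lines). Theorem. An order $\mathfrak{H}$ in $\mathbb{M}_2(K)$, not necessarily full, is Bass if and only if its branch $\mathfrak{s}_K(\mathfrak{H})$ is a line in $\mathfrak{t}(K)$. -/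

import Mathlib

open scoped ValuativeRel

namespace BassOrders

section Orders

variable (K : Type*) [Field K] [ValuativeRel K]

/-- The matrix algebra `M₂(K)`. -/
abbrev Mat : Type _ := Matrix (Fin 2) (Fin 2) K

variable {K}

/-- An order of `M₂(K)`, not necessarily of maximal rank: a subring with `1` that is a finitely
generated `𝒪[K]`-module. -/
def IsOrder (R : Subalgebra 𝒪[K] (Mat K)) : Prop :=
  (Subalgebra.toSubmodule R).FG

/-- A full order: an order of maximal rank, that is, one that spans `M₂(K)` over `K`. -/
def IsFullOrder (R : Subalgebra 𝒪[K] (Mat K)) : Prop :=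
  IsOrder R ∧ Submodule.span K (R : Set (Mat K)) = ⊤

/-- A maximal order: a full order that is not properly contained in another one. -/
def IsMaximalOrder (D : Subalgebra 𝒪[K] (Mat K)) : Prop :=
  Maximal IsFullOrder D

/-- The codifferent `{a | tr (a R) ⊆ 𝒪[K]}`. -/
def codiff (R : Subalgebra 𝒪[K] (Mat K)) : Submodule 𝒪[K] (Mat K) where
  carrier := {a | ∀ x ∈ R, Matrix.trace (a * x) ∈ 𝒪[K]}
  zero_mem' := by
    intro x _
    rw [zero_mul, Matrix.trace_zero]
    exact 𝒪[K].zero_mem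
  add_mem' := by
    intro a b ha hb x hx
    rw [add_mul, Matrix.trace_add]
    exact 𝒪[K].add_mem (ha x hx) (hb x hx)
  smul_mem' := by
    intro c a ha x hx
    rw [smul_mul_assoc, Matrix.trace_smul]
    exact 𝒪[K].mul_mem c.2 (ha x hx)

/-- A two-sided fractional `R`-ideal: a lattice of `M₂(K)` that is stable under multiplication by
`R` on the left and on the right. -/
structure IsTwoSidedFractionalIdeal (R : Subalgebra 𝒪[K] (Mat K))
    (I : Submodule 𝒪[K] (Mat K)) : Prop where
  fg : I.FG
  span_eq_top : Submodule.span K (I : Set (Mat K)) = ⊤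
  left_mul_mem : ∀ x ∈ R, ∀ a ∈ I, x * a ∈ I
  mul_right_mem : ∀ a ∈ I, ∀ x ∈ R, a * x ∈ I

/-- `I` is invertible as a two-sided fractional `R`-ideal: `I J = J I = R` for some two-sided
fractional `R`-ideal `J`. -/
def IsInvertibleIdeal (R : Subalgebra 𝒪[K] (Mat K)) (I : Submodule 𝒪[K] (Mat K)) : Prop :=
  IsTwoSidedFractionalIdeal R I ∧
    ∃ J : Submodule 𝒪[K] (Mat K), IsTwoSidedFractionalIdeal R J ∧
      I * J = Subalgebra.toSubmodule R ∧ J * I = Subalgebra.toSubmodule R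

/-- A Gorenstein order: a full order whose codifferent is invertible. -/
def IsGorenstein (R : Subalgebra 𝒪[K] (Mat K)) : Prop :=
  IsFullOrder R ∧ IsInvertibleIdeal R (codiff R)

/-- `H` is Bass if every full order containing `H` is Gorenstein. If `H` is itself full, every order
containing it is full, so that the word full may be dropped: see `isBass_iff_of_isFullOrder`. -/
def IsBass (H : Subalgebra 𝒪[K] (Mat K)) : Prop :=
  ∀ R : Subalgebra 𝒪[K] (Mat K), IsFullOrder R → H ≤ R → IsGorenstein R

theorem isBass_iff_of_isFullOrder {H : Subalgebra 𝒪[K] (Mat K)} (hH : IsFullOrder H) :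
    IsBass H ↔ ∀ R : Subalgebra 𝒪[K] (Mat K), IsOrder R → H ≤ R → IsGorenstein R := by
  refine ⟨fun h R hR hle => h R ⟨hR, ?_⟩ hle, fun h R hR hle => h R hR.1 hle⟩
  exact top_le_iff.1 (hH.2 ▸ Submodule.span_mono hle)

/-! ### The Bruhat-Tits tree -/

/-- `D = g M₂(𝒪) g⁻¹`. -/
def IsStdIn (g : GL (Fin 2) K) (D : Subalgebra 𝒪[K] (Mat K)) : Prop :=
  ∀ x : Mat K, x ∈ D ↔
    ∀ i j, ((g⁻¹ : GL (Fin 2) K).1 * x * g.1) i j ∈ 𝒪[K]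

/-- `D = g [[𝒪, ϖ⁻¹𝒪], [ϖ𝒪, 𝒪]] g⁻¹`. -/
def IsShiftIn (ϖ : 𝒪[K]) (g : GL (Fin 2) K) (D : Subalgebra 𝒪[K] (Mat K)) : Prop :=
  ∀ x : Mat K, x ∈ D ↔
    ∃ a b c d : 𝒪[K], (g⁻¹ : GL (Fin 2) K).1 * x * g.1 =
      !![(a : K), (ϖ : K)⁻¹ * b; (ϖ : K) * c, (d : K)]

/-- Two maximal orders are neighbours if, in some basis, they are `M₂(𝒪)` and
`[[𝒪, ϖ⁻¹𝒪], [ϖ𝒪, 𝒪]]`, with `ϖ` a uniformizer. -/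
def Neighbors (D D' : Subalgebra 𝒪[K] (Mat K)) : Prop :=
  ∃ ϖ : 𝒪[K], Irreducible ϖ ∧ ∃ g : GL (Fin 2) K, IsStdIn g D ∧ IsShiftIn ϖ g D'

theorem Neighbors.symm {D D' : Subalgebra 𝒪[K] (Mat K)} (h : Neighbors D D') :
    Neighbors D' D := by
  obtain ⟨ϖ, hϖ, g, h1, h2⟩ := h
  have h0 : (ϖ : K) ≠ 0 := fun h => hϖ.ne_zero (Subtype.ext h)
  -- the change of basis `diag(1, ϖ)` followed by the swap of the two basis vectors
  let t : GL (Fin 2) K := ⟨!![0, 1; (ϖ : K), 0], !![0, (ϖ : K)⁻¹; 1, 0],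
    by simp [Matrix.one_fin_two, h0], by simp [Matrix.one_fin_two, h0]⟩
  have key : ∀ x : Mat K, ((g * t)⁻¹ : GL (Fin 2) K).1 * x * (g * t).1 =
      !![0, (ϖ : K)⁻¹; 1, 0] * ((g⁻¹ : GL (Fin 2) K).1 * x * g.1) * !![0, 1; (ϖ : K), 0] := by
    intro x
    rw [mul_inv_rev]
    change !![0, (ϖ : K)⁻¹; 1, 0] * (g⁻¹ : GL (Fin 2) K).1 * x * (g.1 * !![0, 1; (ϖ : K), 0]) = _
    simp only [mul_assoc]
  have prod : ∀ y : Mat K, !![0, (ϖ : K)⁻¹; 1, 0] * y * !![0, 1; (ϖ : K), 0] =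
      !![y 1 1, (ϖ : K)⁻¹ * y 1 0; (ϖ : K) * y 0 1, y 0 0] := by
    intro y
    rw [Matrix.eta_fin_two y, Matrix.mul_fin_two, Matrix.mul_fin_two]
    ext i j
    fin_cases i <;> fin_cases j <;> simp [h0, mul_comm]
  refine ⟨ϖ, hϖ, g * t, fun x => ?_, fun x => ?_⟩
  · rw [h2 x, key x, prod]
    generalize (g⁻¹ : GL (Fin 2) K).1 * x * g.1 = y
    constructor
    · rintro ⟨a, b, c, d, rfl⟩ i j
      fin_cases i <;> fin_cases j <;> simp [h0]
    · intro h
      refine ⟨⟨_, h 1 1⟩, ⟨_, h 1 0⟩, ⟨_, h 0 1⟩, ⟨_, h 0 0⟩, ?_⟩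
      ext i j
      fin_cases i <;> fin_cases j <;> simp [h0]
  · rw [h1 x, key x, prod]
    generalize (g⁻¹ : GL (Fin 2) K).1 * x * g.1 = y
    constructor
    · intro h
      exact ⟨⟨_, h 1 1⟩, ⟨_, h 1 0⟩, ⟨_, h 0 1⟩, ⟨_, h 0 0⟩, rfl⟩
    · rintro ⟨a, b, c, d, h⟩
      have e00 := congrFun (congrFun h 0) 0
      have e01 := congrFun (congrFun h 0) 1
      have e10 := congrFun (congrFun h 1) 0
      have e11 := congrFun (congrFun h 1) 1
      simp only [Matrix.of_apply, Matrix.cons_val', Matrix.cons_val_zero, Matrix.cons_val_one,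
        Matrix.cons_val_fin_one] at e00 e01 e10 e11
      have f01 : y 1 0 = b := mul_left_cancel₀ (inv_ne_zero h0) e01
      have f10 : y 0 1 = c := mul_left_cancel₀ h0 e10
      have m00 : y 0 0 ∈ 𝒪[K] := e11 ▸ d.2
      have m01 : y 0 1 ∈ 𝒪[K] := f10 ▸ c.2
      have m10 : y 1 0 ∈ 𝒪[K] := f01 ▸ b.2
      have m11 : y 1 1 ∈ 𝒪[K] := e00 ▸ a.2
      intro i j
      fin_cases i <;> fin_cases j <;> assumption

theorem Neighbors.irrefl (D : Subalgebra 𝒪[K] (Mat K)) : ¬ Neighbors D D := by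
  rintro ⟨ϖ, hϖ, g, h1, h2⟩
  have hg : (g⁻¹ : GL (Fin 2) K).1 * (g.1 * !![0, 0; 1, 0] * (g⁻¹ : GL (Fin 2) K).1) * g.1
      = (!![0, 0; 1, 0] : Mat K) := by
    have e : (g⁻¹ : GL (Fin 2) K).1 * g.1 = 1 := Units.inv_mul g
    calc _ = ((g⁻¹ : GL (Fin 2) K).1 * g.1) * !![0, 0; 1, 0] * ((g⁻¹ : GL (Fin 2) K).1 * g.1) := by
          simp only [mul_assoc]
      _ = _ := by rw [e, one_mul, mul_one]
  have hx : g.1 * !![0, 0; 1, 0] * (g⁻¹ : GL (Fin 2) K).1 ∈ D := by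
    rw [h1, hg]
    intro i j
    fin_cases i <;> fin_cases j <;> simp
  obtain ⟨a, b, c, d, h⟩ := (h2 _).1 hx
  rw [hg] at h
  have e := congrFun (congrFun h 1) 0
  simp at e
  exact hϖ.not_isUnit (IsUnit.of_mul_eq_one c (Subtype.ext e.symm))

variable (K) in
/-- The Bruhat-Tits tree: its vertices are the maximal orders of `M₂(K)`. -/
def bruhatTitsTree : SimpleGraph {D : Subalgebra 𝒪[K] (Mat K) // IsMaximalOrder D} where
  Adj D D' := Neighbors D.1 D'.1
  symm := ⟨fun _ _ h => h.symm⟩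
  loopless := ⟨fun D => Neighbors.irrefl D.1⟩

/-- The vertex set of the branch of `H`: the maximal orders containing `H`. -/
def branch (H : Subalgebra 𝒪[K] (Mat K)) :
    Set {D : Subalgebra 𝒪[K] (Mat K) // IsMaximalOrder D} :=
  {D | H ≤ D.1}

end Orders

/-- The real line graph: the vertices are the integers, and `m`, `n` are adjacent if `|m - n| = 1`. -/
noncomputable abbrev realLine : SimpleGraph ℤ := SimpleGraph.hasse ℤ

/-- The (induced) subgraph of `G` on the vertex set `S` is a line: it is isomorphic to an integral
interval, that is, to a connected (in particular non-empty) subgraph of the real line graph. -/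
def IsLine {V : Type*} (G : SimpleGraph V) (S : Set V) : Prop :=
  ∃ I : Set ℤ, (realLine.induce I).Connected ∧ Nonempty (G.induce S ≃g realLine.induce I)

end BassOrders

/-!
# Bass orders in `M₂(K)` are the orders whose branch is a line

Write `𝒪 = 𝒪[K]` and let `p` be a uniformizer. Both sides of the equivalence say that `H` is
contained in no order `𝒪 + p D` with `D` a maximal order, i.e. that `H` is not scalar modulo `p` at
any vertex of its branch.

*Branches.* The maximal orders are the conjugates `g M₂(𝒪) g⁻¹` (`isMaximalOrder_iff`), and the
neighbours of such a vertex correspond to the lines in the plane over the residue field. A vertex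
and a neighbour of it both contain `H` if and only if the line consists of eigenvectors of `H`
modulo `p`. A matrix with three eigenlines is scalar, so a vertex `D` has three neighbours in the
branch if and only if `H ≤ 𝒪 + p D` (`le_congruenceOrder`, `exists_three_neighbours`). By the Cartan
decomposition any two vertices are joined by a path whose vertices contain the intersection of the
ends (`inf_le_conjOrder`), and the distance from a fixed vertex makes the branch a rooted tree
(`relPos_succ_or`). Such a tree without a vertex of degree three is a line
(`exists_iso_realLine_of_level`).

*Gorenstein orders.* The full orders `𝒪 + p D` are not Gorenstein
(`not_isGorenstein_congruenceOrder`), hence they contain no Bass order. Conversely, let a full order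
`R` have the basis `1, i, j, k`. With `N = tr (i [j, k])`, the form `N det` on the traceless part of
the codifferent is an integral ternary quadratic form. If it takes a unit value at `x`, then the
pairing `tr (x y z)` is perfect on `R`, so that the codifferent is `x R = R x` and `R` is Gorenstein
(`IsOrderBasis.isGorenstein`). Otherwise all its coefficients are divisible by `p`, and as they are
the structure constants of `R` in a suitable basis, `R = 𝒪 + p G` for an order `G`; then
`R ≤ 𝒪 + p D` for every maximal order `D` that contains `G`
(`exists_le_congruenceOrder_of_not_isGorenstein`).
-/

set_option linter.unusedSectionVars false

namespace BassOrders

/-! ### Integral matrices and the conjugates of `M₂(𝒪)` -/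

section Integral

variable {K : Type*} [Field K] [ValuativeRel K]

theorem inv_mem_integer_of_notMem {x : K} (hx : x ∉ 𝒪[K]) : x⁻¹ ∈ 𝒪[K] := by
  rw [Valuation.mem_integer_iff] at hx ⊢
  rw [map_inv₀]
  exact inv_le_one_of_one_le₀ (not_le.1 hx).le

variable (K) in
/-- The matrices with entries in `𝒪`. -/
def intMat : Subalgebra 𝒪[K] (Mat K) where
  carrier := {x | ∀ i j, x i j ∈ 𝒪[K]}
  mul_mem' := by
    intro a b ha hb i j
    rw [Matrix.mul_apply]
    exact sum_mem fun l _ => 𝒪[K].mul_mem (ha i l) (hb l j)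
  add_mem' := fun ha hb i j => 𝒪[K].add_mem (ha i j) (hb i j)
  algebraMap_mem' := by
    intro r i j
    rw [Algebra.algebraMap_eq_smul_one, Matrix.smul_apply, Matrix.one_apply]
    split_ifs
    · rw [Algebra.smul_def, mul_one]
      exact r.2
    · simp

theorem mem_intMat_of {a b c d : K} (ha : a ∈ 𝒪[K]) (hb : b ∈ 𝒪[K]) (hc : c ∈ 𝒪[K])
    (hd : d ∈ 𝒪[K]) : !![a, b; c, d] ∈ intMat K := by
  intro i j
  fin_cases i <;> fin_cases j <;> assumption

theorem smul_mem_of_mem {R : Subalgebra 𝒪[K] (Mat K)} {c : K} (hc : c ∈ 𝒪[K]) {x : Mat K}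
    (hx : x ∈ R) : c • x ∈ R :=
  R.smul_mem hx (⟨c, hc⟩ : 𝒪[K])

/-- The maximal order `g M₂(𝒪) g⁻¹`. -/
def conjOrder (g : GL (Fin 2) K) : Subalgebra 𝒪[K] (Mat K) where
  carrier := {x | (g⁻¹ : GL (Fin 2) K).1 * x * g.1 ∈ intMat K}
  mul_mem' := by
    intro a b ha hb
    have e : (g⁻¹ : GL (Fin 2) K).1 * (a * b) * g.1 =
        ((g⁻¹ : GL (Fin 2) K).1 * a * g.1) * ((g⁻¹ : GL (Fin 2) K).1 * b * g.1) := by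
      simp only [mul_assoc, Units.mul_inv_cancel_left]
    change (g⁻¹ : GL (Fin 2) K).1 * (a * b) * g.1 ∈ intMat K
    exact e ▸ (intMat K).mul_mem ha hb
  add_mem' := by
    intro a b ha hb
    have := (intMat K).add_mem ha hb
    rwa [← add_mul, ← mul_add] at this
  algebraMap_mem' := by
    intro r
    have e : (g⁻¹ : GL (Fin 2) K).1 * algebraMap 𝒪[K] (Mat K) r * g.1 =
        algebraMap 𝒪[K] (Mat K) r := by
      rw [← Algebra.commutes, mul_assoc, Units.inv_mul, mul_one]
    change (g⁻¹ : GL (Fin 2) K).1 * algebraMap 𝒪[K] (Mat K) r * g.1 ∈ intMat K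
    rw [e]
    exact (intMat K).algebraMap_mem r

theorem mem_conjOrder {g : GL (Fin 2) K} {x : Mat K} :
    x ∈ conjOrder g ↔ (g⁻¹ : GL (Fin 2) K).1 * x * g.1 ∈ intMat K := Iff.rfl

theorem isStdIn_iff {g : GL (Fin 2) K} {D : Subalgebra 𝒪[K] (Mat K)} :
    IsStdIn g D ↔ D = conjOrder g :=
  ⟨fun h => Subalgebra.ext h, fun h _ => h ▸ Iff.rfl⟩

theorem conj_mem_conjOrder_mul {g h : GL (Fin 2) K} {y : Mat K} :
    g.1 * y * (g⁻¹ : GL (Fin 2) K).1 ∈ conjOrder (g * h) ↔ y ∈ conjOrder h := by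
  rw [mem_conjOrder, mem_conjOrder, mul_inv_rev, Units.val_mul, Units.val_mul]
  simp only [mul_assoc, Units.inv_mul_cancel_left]

theorem mem_conjOrder_mul {g h : GL (Fin 2) K} {x : Mat K} :
    x ∈ conjOrder (g * h) ↔ (g⁻¹ : GL (Fin 2) K).1 * x * g.1 ∈ conjOrder h := by
  rw [mem_conjOrder, mem_conjOrder, mul_inv_rev, Units.val_mul, Units.val_mul]
  simp only [mul_assoc]

theorem mem_conjOrder_one {x : Mat K} : x ∈ conjOrder 1 ↔ x ∈ intMat K := by
  rw [mem_conjOrder]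
  simp

theorem conj_mem_conjOrder {g : GL (Fin 2) K} {y : Mat K} :
    g.1 * y * (g⁻¹ : GL (Fin 2) K).1 ∈ conjOrder g ↔ y ∈ intMat K := by
  rw [← mem_conjOrder_one, ← conj_mem_conjOrder_mul (g := g) (h := 1), mul_one]

variable (K) in
/-- The group `GL₂(𝒪)` inside `GL₂(K)`. -/
def intGL : Subgroup (GL (Fin 2) K) where
  carrier := {k | k.1 ∈ intMat K ∧ (k⁻¹ : GL (Fin 2) K).1 ∈ intMat K}
  mul_mem' := by
    rintro a b ⟨ha, ha'⟩ ⟨hb, hb'⟩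
    refine ⟨(intMat K).mul_mem ha hb, ?_⟩
    rw [mul_inv_rev]
    exact (intMat K).mul_mem hb' ha'
  one_mem' := by simp [one_mem]
  inv_mem' := by
    rintro a ⟨ha, ha'⟩
    exact ⟨ha', by rwa [inv_inv]⟩

theorem mem_intGL_of_det {k : GL (Fin 2) K} (hk : k.1 ∈ intMat K) (hd : (k.1.det)⁻¹ ∈ 𝒪[K]) :
    k ∈ intGL K := by
  refine ⟨hk, ?_⟩
  have e : (k⁻¹ : GL (Fin 2) K).1 = (k.1.det)⁻¹ • Matrix.adjugate k.1 := by
    rw [Matrix.coe_units_inv, Matrix.inv_def, Ring.inverse_eq_inv']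
  rw [e, Matrix.adjugate_fin_two]
  exact smul_mem_of_mem hd (mem_intMat_of (hk _ _) (𝒪[K].neg_mem (hk _ _))
    (𝒪[K].neg_mem (hk _ _)) (hk _ _))

theorem det_mem_of_mem_intMat {x : Mat K} (hx : x ∈ intMat K) : x.det ∈ 𝒪[K] := by
  rw [Matrix.det_fin_two]
  exact 𝒪[K].sub_mem (𝒪[K].mul_mem (hx _ _) (hx _ _)) (𝒪[K].mul_mem (hx _ _) (hx _ _))

theorem det_inv_mem_of_mem_intGL {k : GL (Fin 2) K} (hk : k ∈ intGL K) :
    (k.1.det)⁻¹ ∈ 𝒪[K] := by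
  have e : (k⁻¹ : GL (Fin 2) K).1.det = (k.1.det)⁻¹ := by
    rw [Matrix.coe_units_inv, Matrix.det_nonsing_inv, Ring.inverse_eq_inv']
  exact e ▸ det_mem_of_mem_intMat hk.2

theorem det_unit_ne_zero (g : GL (Fin 2) K) : g.1.det ≠ 0 :=
  ((Matrix.isUnit_iff_isUnit_det _).1 g.isUnit).ne_zero

/-- An invertible matrix from its entries. -/
noncomputable def mkGL (a b c d : K) (h : a * d - b * c ≠ 0) : GL (Fin 2) K :=
  Matrix.GeneralLinearGroup.mkOfDetNeZero !![a, b; c, d] (by rwa [Matrix.det_fin_two_of])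

theorem coe_mkGL (a b c d : K) (h : a * d - b * c ≠ 0) : (mkGL a b c d h).1 = !![a, b; c, d] := rfl

theorem mkGL_mem_intGL {a b c d : K} (h : a * d - b * c ≠ 0) (ha : a ∈ 𝒪[K]) (hb : b ∈ 𝒪[K])
    (hc : c ∈ 𝒪[K]) (hd : d ∈ 𝒪[K]) (h' : (a * d - b * c)⁻¹ ∈ 𝒪[K]) :
    mkGL a b c d h ∈ intGL K :=
  mem_intGL_of_det (mem_intMat_of ha hb hc hd) (by rwa [coe_mkGL, Matrix.det_fin_two_of])

theorem conjOrder_of_mem_intGL {k : GL (Fin 2) K} (hk : k ∈ intGL K) :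
    conjOrder k = conjOrder 1 := by
  ext x
  rw [mem_conjOrder_one, mem_conjOrder]
  refine ⟨fun h => ?_, fun h => (intMat K).mul_mem ((intMat K).mul_mem hk.2 h) hk.1⟩
  have := (intMat K).mul_mem ((intMat K).mul_mem hk.1 h) hk.2
  simpa only [mul_assoc, Units.mul_inv_cancel_left, Units.mul_inv, mul_one] using this

theorem conjOrder_congr (g : GL (Fin 2) K) {h h' : GL (Fin 2) K} (e : conjOrder h = conjOrder h') :
    conjOrder (g * h) = conjOrder (g * h') := by
  ext x
  rw [mem_conjOrder_mul, mem_conjOrder_mul, e]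

theorem conjOrder_mul_of_mem_intGL (g : GL (Fin 2) K) {k : GL (Fin 2) K} (hk : k ∈ intGL K) :
    conjOrder (g * k) = conjOrder g := by
  rw [conjOrder_congr g (conjOrder_of_mem_intGL hk), mul_one]

/-- The scalar matrix `c`. -/
def scalarGL (c : Kˣ) : GL (Fin 2) K := Units.map (algebraMap K (Mat K)).toMonoidHom c

theorem scalarGL_comm (c : Kˣ) (g : GL (Fin 2) K) : scalarGL c * g = g * scalarGL c :=
  Units.ext (Algebra.commutes (c : K) g.1)

theorem conjOrder_mul_scalarGL (g : GL (Fin 2) K) (c : Kˣ) :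
    conjOrder (g * scalarGL c) = conjOrder g := by
  have : conjOrder (scalarGL c) = conjOrder (1 : GL (Fin 2) K) := by
    ext x
    rw [mem_conjOrder_one, mem_conjOrder]
    have e : x * (scalarGL c).1 = (scalarGL c).1 * x := (Algebra.commutes (c : K) x).symm
    rw [mul_assoc, e, Units.inv_mul_cancel_left]
  rw [conjOrder_congr g this, mul_one]

/-- The diagonal matrix `diag(1, t)`. -/
def diagGL (t : Kˣ) : GL (Fin 2) K :=
  ⟨!![1, 0; 0, (t : K)], !![1, 0; 0, (t : K)⁻¹], by simp [Matrix.one_fin_two],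
    by simp [Matrix.one_fin_two]⟩

theorem coe_diagGL (t : Kˣ) : (diagGL t).1 = !![1, 0; 0, (t : K)] := rfl

theorem diagGL_mul (s t : Kˣ) : diagGL (s * t) = diagGL s * diagGL t := by
  apply Units.ext
  rw [Units.val_mul]
  simp [coe_diagGL]

theorem diagGL_one : diagGL (1 : Kˣ) = 1 := by
  apply Units.ext
  simp [coe_diagGL, Matrix.one_fin_two]

theorem diagGL_mem_intGL {t : Kˣ} (h : (t : K) ∈ 𝒪[K]) (h' : (t : K)⁻¹ ∈ 𝒪[K]) :
    diagGL t ∈ intGL K := by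
  refine ⟨mem_intMat_of (𝒪[K].one_mem) 𝒪[K].zero_mem 𝒪[K].zero_mem h, ?_⟩
  exact mem_intMat_of (𝒪[K].one_mem) 𝒪[K].zero_mem 𝒪[K].zero_mem h'

theorem conj_diagGL (t : Kˣ) (x : Mat K) : ((diagGL t)⁻¹ : GL (Fin 2) K).1 * x * (diagGL t).1 =
    !![x 0 0, t * x 0 1; (t : K)⁻¹ * x 1 0, x 1 1] := by
  change !![1, 0; 0, (t : K)⁻¹] * x * !![1, 0; 0, (t : K)] = _
  rw [Matrix.eta_fin_two x, Matrix.mul_fin_two, Matrix.mul_fin_two]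
  ext i j
  fin_cases i <;> fin_cases j <;> simp [mul_comm]

theorem mem_conjOrder_diagGL {t : Kˣ} {x : Mat K} : x ∈ conjOrder (diagGL t) ↔
    x 0 0 ∈ 𝒪[K] ∧ t * x 0 1 ∈ 𝒪[K] ∧ (t : K)⁻¹ * x 1 0 ∈ 𝒪[K] ∧ x 1 1 ∈ 𝒪[K] := by
  rw [mem_conjOrder, conj_diagGL]
  refine ⟨fun h => ⟨h 0 0, h 0 1, h 1 0, h 1 1⟩, fun h => mem_intMat_of h.1 h.2.1 h.2.2.1 h.2.2.2⟩

theorem conj_conj_inv (g : GL (Fin 2) K) (x : Mat K) :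
    g.1 * ((g⁻¹ : GL (Fin 2) K).1 * x * g.1) * (g⁻¹ : GL (Fin 2) K).1 = x := by
  simp only [mul_assoc, Units.mul_inv, mul_one, Units.mul_inv_cancel_left]

theorem conj_inv_conj (g : GL (Fin 2) K) (x : Mat K) :
    (g⁻¹ : GL (Fin 2) K).1 * (g.1 * x * (g⁻¹ : GL (Fin 2) K).1) * g.1 = x := by
  simp only [mul_assoc, Units.inv_mul, mul_one, Units.inv_mul_cancel_left]

/-- A uniformizer of `𝒪`, as a unit of `K`. -/
def IsUnif (p : Kˣ) : Prop := ∃ ϖ : 𝒪[K], Irreducible ϖ ∧ (p : K) = ϖ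

namespace IsUnif

variable {p : Kˣ} (hp : IsUnif p)
include hp

theorem mem : (p : K) ∈ 𝒪[K] := by
  obtain ⟨ϖ, -, h⟩ := hp
  exact h ▸ ϖ.2

theorem pow_mem (n : ℕ) : ((p ^ n : Kˣ) : K) ∈ 𝒪[K] := by
  rw [Units.val_pow_eq_pow_val]
  exact 𝒪[K].pow_mem hp.mem n

theorem inv_notMem : (p : K)⁻¹ ∉ 𝒪[K] := by
  obtain ⟨ϖ, hϖ, h⟩ := hp
  intro hi
  refine hϖ.not_isUnit (IsUnit.of_mul_eq_one ⟨_, hi⟩ (Subtype.ext ?_))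
  change (ϖ : K) * (p : K)⁻¹ = 1
  rw [← h, mul_inv_cancel₀ p.ne_zero]

/-- An element of `𝒪` is either a unit or divisible by the uniformizer. -/
theorem inv_mem_or {x : K} (hx : x ∈ 𝒪[K]) : (x ≠ 0 ∧ x⁻¹ ∈ 𝒪[K]) ∨ (p : K)⁻¹ * x ∈ 𝒪[K] := by
  obtain ⟨ϖ, hϖ, h⟩ := hp
  by_cases h0 : x = 0
  · exact Or.inr (by simp [h0])
  by_cases hi : x⁻¹ ∈ 𝒪[K]
  · exact Or.inl ⟨h0, hi⟩
  right
  by_contra hc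
  have := inv_mem_integer_of_notMem hc
  rw [mul_inv, inv_inv] at this
  -- `ϖ = x * (ϖ / x)` with neither factor a unit
  rcases hϖ.isUnit_or_isUnit (a := ⟨x, hx⟩) (b := ⟨_, this⟩) (Subtype.ext (by
    change (ϖ : K) = x * ((p : K) * x⁻¹)
    rw [← h]
    field_simp)) with hu | hu
  · obtain ⟨y, hy⟩ := hu.exists_right_inv
    have hy' : x * (y : K) = 1 := congrArg Subtype.val hy
    exact hi (by rw [inv_eq_of_mul_eq_one_right hy']; exact y.2)
  · obtain ⟨y, hy⟩ := hu.exists_right_inv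
    have hy' : (p * x⁻¹) * (y : K) = 1 := congrArg Subtype.val hy
    apply hc
    have : (p : K)⁻¹ * x = y := by
      rw [← inv_eq_of_mul_eq_one_right hy', mul_inv, inv_inv]
    rw [this]
    exact y.2

theorem pow_inv_notMem {n : ℕ} (hn : n ≠ 0) : ((p ^ n : Kˣ) : K)⁻¹ ∉ 𝒪[K] := by
  intro h
  apply hp.inv_notMem
  obtain ⟨m, rfl⟩ := Nat.exists_eq_succ_of_ne_zero hn
  have := 𝒪[K].mul_mem h (hp.pow_mem m)
  rwa [pow_succ, Units.val_mul, mul_inv, mul_comm, ← mul_assoc,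
    mul_inv_cancel₀ (p ^ m).ne_zero, one_mul] at this

variable [IsDiscreteValuationRing 𝒪[K]]

theorem exists_unit_mul_pow {x : K} (hx : x ∈ 𝒪[K]) (h0 : x ≠ 0) :
    ∃ (n : ℕ) (u : Kˣ), (u : K) ∈ 𝒪[K] ∧ (u : K)⁻¹ ∈ 𝒪[K] ∧ x = u * (p ^ n : Kˣ) := by
  obtain ⟨ϖ, hϖ, h⟩ := hp
  obtain ⟨n, u, hu⟩ := IsDiscreteValuationRing.eq_unit_mul_pow_irreducible
    (x := (⟨x, hx⟩ : 𝒪[K])) (fun h => h0 (congrArg Subtype.val h)) hϖ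
  have e : (u : 𝒪[K]).1 * (u⁻¹ : 𝒪[K]ˣ).1.1 = 1 := congrArg Subtype.val u.mul_inv
  have hu0 : ((u : 𝒪[K]) : K) ≠ 0 := left_ne_zero_of_mul_eq_one e
  refine ⟨n, Units.mk0 _ hu0, u.1.2, ?_, ?_⟩
  · rw [Units.val_mk0, inv_eq_of_mul_eq_one_right e]
    exact (u⁻¹ : 𝒪[K]ˣ).1.2
  · rw [Units.val_mk0, Units.val_pow_eq_pow_val, h]
    exact congrArg Subtype.val hu

end IsUnif

theorem exists_isUnif [IsDiscreteValuationRing 𝒪[K]] : ∃ p : Kˣ, IsUnif p := by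
  obtain ⟨ϖ, hϖ⟩ := IsDiscreteValuationRing.exists_irreducible 𝒪[K]
  exact ⟨Units.mk0 (ϖ : K) fun h => hϖ.ne_zero (Subtype.ext h), ϖ, hϖ, rfl⟩

/-- Two uniformizers differ by a unit. -/
theorem IsUnif.div_mem {p q : Kˣ} (hp : IsUnif p) (hq : IsUnif q) :
    (p : K)⁻¹ * q ∈ 𝒪[K] := by
  rcases hp.inv_mem_or hq.mem with h | h
  · exact absurd h.2 hq.inv_notMem
  · exact h

end Integral

/-! ### Relative position of two conjugates of `M₂(𝒪)` -/

section RelativePosition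

variable {K : Type*} [Field K] [ValuativeRel K] [IsDiscreteValuationRing 𝒪[K]]

theorem exists_cartan_of_dvd {p : Kˣ} (hp : IsUnif p) {h : GL (Fin 2) K} {x b c d : K}
    (hb : b ∈ 𝒪[K]) (hc : c ∈ 𝒪[K]) (hd : d ∈ 𝒪[K]) (e : h.1 = !![x, b * x; c * x, d * x]) :
    ∃ k ∈ intGL K, ∃ k' ∈ intGL K, ∃ (n : ℕ) (z : Kˣ),
      h = k * diagGL (p ^ n) * scalarGL z * k' := by
  have hdet := det_unit_ne_zero h
  rw [e, Matrix.det_fin_two_of] at hdet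
  have hx : x ≠ 0 := by
    rintro rfl
    simp at hdet
  have hs : d - c * b ≠ 0 := by
    intro h0
    apply hdet
    linear_combination x ^ 2 * h0
  obtain ⟨n, u, hu, hu', hn⟩ := hp.exists_unit_mul_pow
    (𝒪[K].sub_mem hd (𝒪[K].mul_mem hc hb)) hs
  have h1 : (1 : K) ∈ 𝒪[K] := 𝒪[K].one_mem
  have h0 : (0 : K) ∈ 𝒪[K] := 𝒪[K].zero_mem
  refine ⟨mkGL 1 0 c 1 (by simp) * diagGL u,
    (intGL K).mul_mem (mkGL_mem_intGL _ h1 h0 hc h1 (by simp)) (diagGL_mem_intGL hu hu'),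
    mkGL 1 b 0 1 (by simp), mkGL_mem_intGL _ h1 hb h0 h1 (by simp), n, Units.mk0 x hx, ?_⟩
  rw [mul_assoc (mkGL 1 0 c 1 _), ← diagGL_mul, mul_assoc _ (scalarGL _), scalarGL_comm]
  apply Units.ext
  simp only [Units.val_mul, coe_mkGL, coe_diagGL, scalarGL]
  rw [← hn, e]
  change _ = _ * _ * (_ * algebraMap K (Mat K) x)
  rw [Algebra.algebraMap_eq_smul_one, mul_smul_comm, mul_one]
  ext i j
  fin_cases i <;> fin_cases j <;> simp [Matrix.mul_apply, Fin.sum_univ_two] <;> ring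

/-- The Cartan decomposition of `GL₂(K)`: the entry of largest absolute value is moved to the
upper left corner, and then used to clear its row and its column. -/
theorem exists_cartan {p : Kˣ} (hp : IsUnif p) (h : GL (Fin 2) K) :
    ∃ k ∈ intGL K, ∃ k' ∈ intGL K, ∃ (n : ℕ) (z : Kˣ),
      h = k * diagGL (p ^ n) * scalarGL z * k' := by
  obtain ⟨⟨i, j⟩, hij⟩ := Finite.exists_max
    (fun q : Fin 2 × Fin 2 => ValuativeRel.valuation K (h.1 q.1 q.2))
  have hne : h.1 i j ≠ 0 := by
    intro h0
    apply det_unit_ne_zero h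
    have hz : ∀ a b, h.1 a b = 0 := fun a b => by
      have := hij (a, b)
      simpa [h0] using this
    rw [Matrix.det_fin_two, hz, hz, hz]
    simp
  have hdvd : ∀ a b, ∃ r ∈ 𝒪[K], h.1 a b = r * h.1 i j := fun a b => by
    refine ⟨h.1 a b / h.1 i j, ?_, by field_simp⟩
    rw [Valuation.mem_integer_iff, map_div₀]
    exact div_le_one_of_le₀ (hij (a, b)) zero_le
  have h1 : (1 : K) ∈ 𝒪[K] := 𝒪[K].one_mem
  have h0 : (0 : K) ∈ 𝒪[K] := 𝒪[K].zero_mem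
  let w : GL (Fin 2) K := mkGL 0 1 1 0 (by simp)
  have hw : w ∈ intGL K := mkGL_mem_intGL _ h0 h1 h1 h0 (by
    simp only [mul_zero, zero_sub, mul_one, inv_neg, inv_one]
    exact 𝒪[K].neg_mem h1)
  have hwe : w.1 = !![0, 1; 1, 0] := rfl
  have key : ∀ s ∈ intGL K, ∀ t ∈ intGL K, ∀ b ∈ 𝒪[K], ∀ c ∈ 𝒪[K], ∀ d ∈ 𝒪[K],
      (s * h * t).1 = !![h.1 i j, b * h.1 i j; c * h.1 i j, d * h.1 i j] →
      ∃ k ∈ intGL K, ∃ k' ∈ intGL K, ∃ (n : ℕ) (z : Kˣ),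
        h = k * diagGL (p ^ n) * scalarGL z * k' := by
    intro s hs t ht b hb c hc d hd e
    obtain ⟨k, hk, k', hk', n, z, e'⟩ := exists_cartan_of_dvd hp hb hc hd e
    refine ⟨s⁻¹ * k, (intGL K).mul_mem ((intGL K).inv_mem hs) hk, k' * t⁻¹,
      (intGL K).mul_mem hk' ((intGL K).inv_mem ht), n, z, ?_⟩
    have : h = s⁻¹ * (s * h * t) * t⁻¹ := by group
    rw [this, e']
    group
  obtain ⟨r00, hr00, e00⟩ := hdvd 0 0
  obtain ⟨r01, hr01, e01⟩ := hdvd 0 1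
  obtain ⟨r10, hr10, e10⟩ := hdvd 1 0
  obtain ⟨r11, hr11, e11⟩ := hdvd 1 1
  have one := (intGL K).one_mem
  have hs : h.1 = !![h.1 0 0, h.1 0 1; h.1 1 0, h.1 1 1] := Matrix.eta_fin_two _
  fin_cases i <;> fin_cases j <;> simp only [Fin.zero_eta, Fin.mk_one, Fin.isValue] at *
  · refine key 1 one 1 one r01 hr01 r10 hr10 r11 hr11 ?_
    rw [one_mul, mul_one, ← e01, ← e10, ← e11]
    exact hs
  · refine key 1 one w hw r00 hr00 r11 hr11 r10 hr10 ?_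
    rw [one_mul, ← e00, ← e10, ← e11, Units.val_mul, hwe]
    nth_rw 1 [hs]
    simp
  · refine key w hw 1 one r11 hr11 r00 hr00 r01 hr01 ?_
    rw [mul_one, ← e00, ← e01, ← e11, Units.val_mul, hwe]
    nth_rw 1 [hs]
    simp
  · refine key w hw w hw r10 hr10 r01 hr01 r00 hr00 ?_
    rw [← e00, ← e10, ← e01, Units.val_mul, Units.val_mul, hwe]
    nth_rw 1 [hs]
    simp

/-- `D` and `D'` are at distance `n` in the Bruhat-Tits tree: in a suitable basis they are
`M₂(𝒪)` and `[[𝒪, p⁻ⁿ𝒪], [pⁿ𝒪, 𝒪]]`. -/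
def RelPos (p : Kˣ) (n : ℕ) (D D' : Subalgebra 𝒪[K] (Mat K)) : Prop :=
  ∃ g : GL (Fin 2) K, D = conjOrder g ∧ D' = conjOrder (g * diagGL (p ^ n))

theorem exists_relPos {p : Kˣ} (hp : IsUnif p) (g h : GL (Fin 2) K) :
    ∃ n, RelPos p n (conjOrder g) (conjOrder h) := by
  obtain ⟨k, hk, k', hk', n, z, e⟩ := exists_cartan hp (g⁻¹ * h)
  refine ⟨n, g * k, (conjOrder_mul_of_mem_intGL g hk).symm, ?_⟩
  rw [← mul_inv_cancel_left g h, e, ← mul_assoc, conjOrder_mul_of_mem_intGL _ hk', ← mul_assoc,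
    conjOrder_mul_scalarGL, mul_assoc]

/-- The distance `n` is determined by the two orders: `pᵐ D ⊆ D'` if and only if `n ≤ m`. -/
theorem RelPos.forall_smul_mem_iff {p : Kˣ} (hp : IsUnif p) {n : ℕ}
    {D D' : Subalgebra 𝒪[K] (Mat K)} (h : RelPos p n D D') (m : ℕ) :
    (∀ x ∈ D, ((p ^ m : Kˣ) : K) • x ∈ D') ↔ n ≤ m := by
  obtain ⟨g, rfl, rfl⟩ := h
  constructor
  · intro h
    by_contra! hlt
    have hx := h (g.1 * !![0, 0; 1, 0] * (g⁻¹ : GL (Fin 2) K).1)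
      (conj_mem_conjOrder.2 (mem_intMat_of 𝒪[K].zero_mem 𝒪[K].zero_mem 𝒪[K].one_mem
        𝒪[K].zero_mem))
    rw [← smul_mul_assoc, ← mul_smul_comm, conj_mem_conjOrder_mul, mem_conjOrder_diagGL] at hx
    refine hp.pow_inv_notMem (n := n - m) (by omega) ?_
    have := hx.2.2.1
    obtain ⟨l, rfl⟩ := Nat.exists_eq_add_of_lt hlt
    rw [show m + l + 1 = m + (m + l + 1 - m) by omega, pow_add, Units.val_mul] at this
    simpa using this
  · rintro hle x hx
    rw [mem_conjOrder_mul, mul_smul_comm, smul_mul_assoc, mem_conjOrder_diagGL]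
    rw [mem_conjOrder] at hx
    obtain ⟨l, rfl⟩ := Nat.exists_eq_add_of_le hle
    refine ⟨𝒪[K].mul_mem (hp.pow_mem _) (hx _ _),
      𝒪[K].mul_mem (hp.pow_mem _) (𝒪[K].mul_mem (hp.pow_mem _) (hx _ _)), ?_,
      𝒪[K].mul_mem (hp.pow_mem _) (hx _ _)⟩
    rw [Matrix.smul_apply, smul_eq_mul, pow_add, Units.val_mul, mul_assoc,
      inv_mul_cancel_left₀ (Units.ne_zero _)]
    exact 𝒪[K].mul_mem (hp.pow_mem _) (hx _ _)

theorem RelPos.unique {p : Kˣ} (hp : IsUnif p) {n m : ℕ} {D D' : Subalgebra 𝒪[K] (Mat K)}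
    (h : RelPos p n D D') (h' : RelPos p m D D') : n = m :=
  le_antisymm ((h.forall_smul_mem_iff hp m).1 ((h'.forall_smul_mem_iff hp m).2 le_rfl))
    ((h'.forall_smul_mem_iff hp n).1 ((h.forall_smul_mem_iff hp n).2 le_rfl))

theorem relPos_zero_iff {p : Kˣ} {D D' : Subalgebra 𝒪[K] (Mat K)} :
    RelPos p 0 D D' ↔ D' = D ∧ ∃ g, D = conjOrder g := by
  simp only [RelPos, pow_zero, diagGL_one, mul_one]
  constructor
  · rintro ⟨g, rfl, rfl⟩
    exact ⟨rfl, g, rfl⟩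
  · rintro ⟨rfl, g, rfl⟩
    exact ⟨g, rfl, rfl⟩

/-- The normalizer of `M₂(𝒪)` is `K^× GL₂(𝒪)`. -/
theorem exists_of_conjOrder_eq {g h : GL (Fin 2) K} (e : conjOrder g = conjOrder h) :
    ∃ k ∈ intGL K, ∃ z : Kˣ, h = g * k * scalarGL z := by
  obtain ⟨p, hp⟩ := exists_isUnif (K := K)
  obtain ⟨k, hk, k', hk', n, z, he⟩ := exists_cartan hp (g⁻¹ * h)
  have h1 : RelPos p n (conjOrder g) (conjOrder h) := by
    refine ⟨g * k, (conjOrder_mul_of_mem_intGL g hk).symm, ?_⟩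
    rw [← mul_inv_cancel_left g h, he, ← mul_assoc, conjOrder_mul_of_mem_intGL _ hk', ← mul_assoc,
      conjOrder_mul_scalarGL, mul_assoc]
  have h0 : RelPos p 0 (conjOrder g) (conjOrder h) := relPos_zero_iff.2 ⟨e.symm, g, rfl⟩
  obtain rfl := h1.unique hp h0
  refine ⟨k * k', (intGL K).mul_mem hk hk', z, ?_⟩
  rw [← mul_inv_cancel_left g h, he, pow_zero, diagGL_one, mul_one, mul_assoc k, scalarGL_comm]
  simp only [mul_assoc]

theorem isShiftIn_iff {ϖ : 𝒪[K]} {t : Kˣ} (ht : (t : K) = ϖ) {g : GL (Fin 2) K}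
    {D : Subalgebra 𝒪[K] (Mat K)} : IsShiftIn ϖ g D ↔ D = conjOrder (g * diagGL t) := by
  have key : ∀ x : Mat K, x ∈ conjOrder (g * diagGL t) ↔ ∃ a b c d : 𝒪[K],
      (g⁻¹ : GL (Fin 2) K).1 * x * g.1 = !![(a : K), (ϖ : K)⁻¹ * b; (ϖ : K) * c, (d : K)] := by
    intro x
    rw [mem_conjOrder_mul, mem_conjOrder_diagGL, ← ht]
    have h0 := t.ne_zero
    constructor
    · rintro ⟨h1, h2, h3, h4⟩
      refine ⟨⟨_, h1⟩, ⟨_, h2⟩, ⟨_, h3⟩, ⟨_, h4⟩, ?_⟩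
      ext i j
      fin_cases i <;> fin_cases j <;> simp [h0]
    · rintro ⟨a, b, c, d, e⟩
      rw [e]
      simp [h0]
  refine ⟨fun h => Subalgebra.ext fun x => (h x).trans (key x).symm, ?_⟩
  rintro rfl
  exact key

theorem conjOrder_mul_diagGL_eq {p q : Kˣ} (hp : IsUnif p) (hq : IsUnif q) (g : GL (Fin 2) K) :
    conjOrder (g * diagGL q) = conjOrder (g * diagGL p) := by
  have e : q = p * (p⁻¹ * q) := (mul_inv_cancel_left p q).symm
  rw [e, diagGL_mul, ← mul_assoc, conjOrder_mul_of_mem_intGL]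
  apply diagGL_mem_intGL
  · simpa using hp.div_mem hq
  · have := hq.div_mem hp
    rw [mul_comm] at this
    simpa [mul_comm] using this

theorem neighbors_iff_relPos {p : Kˣ} (hp : IsUnif p) {D D' : Subalgebra 𝒪[K] (Mat K)} :
    Neighbors D D' ↔ RelPos p 1 D D' := by
  constructor
  · rintro ⟨ϖ, hϖ, g, h1, h2⟩
    have h0 : (ϖ : K) ≠ 0 := fun h => hϖ.ne_zero (Subtype.ext h)
    refine ⟨g, isStdIn_iff.1 h1, ?_⟩
    rw [(isShiftIn_iff (t := Units.mk0 _ h0) rfl).1 h2, pow_one]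
    exact conjOrder_mul_diagGL_eq hp ⟨ϖ, hϖ, rfl⟩ g
  · rintro ⟨g, h1, h2⟩
    obtain ⟨ϖ, hϖ, e⟩ := id hp
    exact ⟨ϖ, hϖ, g, isStdIn_iff.2 h1, (isShiftIn_iff e).2 (by rw [h2, pow_one])⟩

/-- The neighbours of `conjOrder g` are the `conjOrder (g * k * diag(1, p))` for `k ∈ GL₂(𝒪)`. -/
theorem relPos_one_conjOrder_iff {p : Kˣ} {g : GL (Fin 2) K} {D' : Subalgebra 𝒪[K] (Mat K)} :
    RelPos p 1 (conjOrder g) D' ↔ ∃ k ∈ intGL K, D' = conjOrder (g * (k * diagGL p)) := by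
  rw [RelPos, pow_one]
  constructor
  · rintro ⟨h, h1, rfl⟩
    obtain ⟨k, hk, z, rfl⟩ := exists_of_conjOrder_eq h1
    refine ⟨k, hk, ?_⟩
    rw [mul_assoc _ (scalarGL z), scalarGL_comm, ← mul_assoc, conjOrder_mul_scalarGL, mul_assoc]
  · rintro ⟨k, hk, rfl⟩
    exact ⟨g * k, (conjOrder_mul_of_mem_intGL g hk).symm, by rw [mul_assoc]⟩

/-- A neighbour of a vertex at distance `n` from a base vertex is either at distance `n + 1`, or it
is the next to last vertex of the path from the base vertex. This makes the graph a tree. -/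
theorem relPos_succ_or {p : Kˣ} (hp : IsUnif p) {g : GL (Fin 2) K} {n : ℕ}
    {D' : Subalgebra 𝒪[K] (Mat K)} (h : RelPos p 1 (conjOrder (g * diagGL (p ^ n))) D') :
    RelPos p (n + 1) (conjOrder g) D' ∨
      ∃ m, n = m + 1 ∧ D' = conjOrder (g * diagGL (p ^ m)) := by
  obtain ⟨k, hk, rfl⟩ := relPos_one_conjOrder_iff.1 h
  have hkd : k.1.det = k.1 0 0 * k.1 1 1 - k.1 0 1 * k.1 1 0 := Matrix.det_fin_two _
  have hdet := det_unit_ne_zero k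
  have hdet' := det_inv_mem_of_mem_intGL hk
  rw [hkd] at hdet hdet'
  have hke : k.1 = !![k.1 0 0, k.1 0 1; k.1 1 0, k.1 1 1] := Matrix.eta_fin_two _
  have ha := hk.1 0 0
  have hb := hk.1 0 1
  have hc := hk.1 1 0
  have hd := hk.1 1 1
  have h1 : (1 : K) ∈ 𝒪[K] := 𝒪[K].one_mem
  have h0 : (0 : K) ∈ 𝒪[K] := 𝒪[K].zero_mem
  generalize k.1 0 0 = a at *
  generalize k.1 0 1 = b at *
  generalize k.1 1 0 = c at *
  generalize k.1 1 1 = d at *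
  rcases hp.inv_mem_or ha with ⟨ha0, hai⟩ | hpa
  · -- `diag(1, pⁿ) k diag(1, p)` lies in `k₁ diag(1, pⁿ⁺¹) GL₂(𝒪)` with `k₁` lower triangular
    left
    have hn1 : a * (d - c * b * a⁻¹) - 0 * (c * (p ^ n : Kˣ)) = a * d - b * c := by
      field_simp
      ring
    have e : diagGL (p ^ n) * (k * diagGL p) =
        mkGL a 0 (c * (p ^ n : Kˣ)) (d - c * b * a⁻¹) (hn1 ▸ hdet) * diagGL (p ^ (n + 1)) *
          mkGL 1 (b * p * a⁻¹) 0 1 (by simp) := by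
      apply Units.ext
      simp only [Units.val_mul, coe_mkGL, coe_diagGL]
      rw [hke, Units.val_pow_eq_pow_val, Units.val_pow_eq_pow_val]
      ext i j
      fin_cases i <;> fin_cases j <;> simp [Matrix.mul_apply, Fin.sum_univ_two] <;>
        field_simp
      ring
    refine ⟨g * mkGL a 0 (c * (p ^ n : Kˣ)) (d - c * b * a⁻¹) (hn1 ▸ hdet), ?_, ?_⟩
    · rw [conjOrder_mul_of_mem_intGL]
      exact mkGL_mem_intGL _ ha h0 (𝒪[K].mul_mem hc (hp.pow_mem n))
        (𝒪[K].sub_mem hd (𝒪[K].mul_mem (𝒪[K].mul_mem hc hb) hai)) (hn1 ▸ hdet')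
    · rw [mul_assoc g, e, ← mul_assoc, conjOrder_mul_of_mem_intGL, ← mul_assoc]
      exact mkGL_mem_intGL _ h1 (𝒪[K].mul_mem (𝒪[K].mul_mem hb hp.mem) hai) h0 h1 (by simp)
  · rcases n with _ | m
    · left
      simpa [diagGL_one] using h
    · right
      refine ⟨m, rfl, ?_⟩
      have hn1 : ((p : K)⁻¹ * a) * (d * p) - b * c = a * d - b * c := by
        have := p.ne_zero
        field_simp
      have e : diagGL (p ^ (m + 1)) * (k * diagGL p) =
          diagGL (p ^ m) * mkGL ((p : K)⁻¹ * a) b c (d * p) (hn1 ▸ hdet) * scalarGL p := by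
        rw [mul_assoc _ _ (scalarGL p), ← scalarGL_comm]
        apply Units.ext
        simp only [Units.val_mul, coe_mkGL, coe_diagGL, scalarGL]
        rw [hke, Units.val_pow_eq_pow_val, Units.val_pow_eq_pow_val]
        change _ = _ * (algebraMap K (Mat K) p * _)
        rw [Algebra.algebraMap_eq_smul_one, smul_mul_assoc, one_mul]
        ext i j
        fin_cases i <;> fin_cases j <;> simp [Matrix.mul_apply, Fin.sum_univ_two] <;> ring
      rw [mul_assoc g, e, ← mul_assoc, conjOrder_mul_scalarGL, ← mul_assoc,
        conjOrder_mul_of_mem_intGL]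
      exact mkGL_mem_intGL _ hpa hb hc (𝒪[K].mul_mem hd hp.mem) (hn1 ▸ hdet')

/-- Branches are convex: the path between two vertices consists of orders that contain the
intersection of the two ends. -/
theorem inf_le_conjOrder {p : Kˣ} (hp : IsUnif p) (g : GL (Fin 2) K) (m : ℕ) :
    conjOrder g ⊓ conjOrder (g * diagGL (p ^ (m + 1))) ≤ conjOrder (g * diagGL (p ^ m)) := by
  rintro x ⟨h1, h2⟩
  change x ∈ conjOrder g at h1
  change x ∈ conjOrder (g * diagGL (p ^ (m + 1))) at h2
  rw [mem_conjOrder] at h1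
  rw [mem_conjOrder_mul, mem_conjOrder_diagGL] at h2 ⊢
  refine ⟨h2.1, 𝒪[K].mul_mem (hp.pow_mem m) (h1 0 1), ?_, h2.2.2.2⟩
  have := 𝒪[K].mul_mem hp.mem h2.2.2.1
  rw [pow_succ, Units.val_mul, mul_inv, mul_comm (_⁻¹) ((p : K)⁻¹), mul_assoc,
    mul_inv_cancel_left₀ p.ne_zero] at this
  exact this

theorem relPos_one_conjOrder_succ (p : Kˣ) (g : GL (Fin 2) K) (m : ℕ) :
    RelPos p 1 (conjOrder (g * diagGL (p ^ m))) (conjOrder (g * diagGL (p ^ (m + 1)))) :=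
  ⟨g * diagGL (p ^ m), rfl, by rw [pow_one, pow_succ, diagGL_mul, mul_assoc]⟩

end RelativePosition

/-! ### Lattices and maximal orders -/

section MaximalOrders

variable {K : Type*} [Field K] [ValuativeRel K] [IsDiscreteValuationRing 𝒪[K]]

theorem exists_basis_of_lattice {n : ℕ} (M : Submodule 𝒪[K] (Fin n → K)) (hfg : M.FG)
    (hspan : Submodule.span K (M : Set (Fin n → K)) = ⊤) :
    ∃ b : Module.Basis (Fin n) K (Fin n → K), ∀ v, v ∈ M ↔ ∀ i, b.repr v i ∈ 𝒪[K] := by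
  have : Submodule.IsLattice K M := ⟨hfg, hspan⟩
  have hr : Module.finrank 𝒪[K] M = n := by
    rw [Submodule.IsLattice.finrank_of_pi (K := K), Fintype.card_fin]
  let b₀ : Module.Basis (Fin n) 𝒪[K] M := Module.finBasisOfFinrankEq 𝒪[K] M hr
  let b := b₀.extendOfIsLattice K
  have hb : ∀ i, b i = b₀ i := fun i => b₀.extendOfIsLattice_apply K i
  refine ⟨b, fun v => ⟨fun hv i => ?_, fun hv => ?_⟩⟩
  · have e : v = ∑ i, ((b₀.repr ⟨v, hv⟩ i : 𝒪[K]) : K) • b i := by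
      have := congrArg Subtype.val (b₀.sum_repr ⟨v, hv⟩)
      rw [Submodule.coe_sum] at this
      refine this.symm.trans (Finset.sum_congr rfl fun i _ => ?_)
      rw [hb]
      rfl
    rw [e, b.repr_sum_self]
    exact Subtype.prop _
  · rw [← b.sum_repr v]
    refine M.sum_mem fun i _ => ?_
    rw [hb]
    exact M.smul_mem (⟨_, hv i⟩ : 𝒪[K]) (b₀ i).2

/-- Every order `H` is contained in some `g M₂(𝒪) g⁻¹`: take for the columns of `g` a basis of the
lattice `H 𝒪²`. -/
theorem exists_le_conjOrder {H : Subalgebra 𝒪[K] (Mat K)} (hH : IsOrder H) :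
    ∃ g : GL (Fin 2) K, H ≤ conjOrder g := by
  let φ : Fin 2 → Mat K →ₗ[𝒪[K]] (Fin 2 → K) := fun j =>
    { toFun := fun x => x.mulVec (Pi.single j 1)
      map_add' := fun x y => Matrix.add_mulVec x y _
      map_smul' := fun c x => Matrix.smul_mulVec c x _ }
  let M : Submodule 𝒪[K] (Fin 2 → K) :=
    ⨆ j, (Subalgebra.toSubmodule H).map (φ j)
  have hM : ∀ j, ∀ x ∈ H, x.mulVec (Pi.single j 1) ∈ M := fun j x hx =>
    Submodule.mem_iSup_of_mem j (Submodule.mem_map_of_mem (f := φ j) hx)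
  have hfg : M.FG := Submodule.fg_iSup _ fun j => Submodule.FG.map _ hH
  have hspan : Submodule.span K (M : Set (Fin 2 → K)) = ⊤ := by
    rw [← top_le_iff, ← (Pi.basisFun K (Fin 2)).span_eq, Submodule.span_le]
    rintro _ ⟨j, rfl⟩
    refine Submodule.subset_span ?_
    have := hM j 1 (one_mem H)
    rw [Matrix.one_mulVec] at this
    rwa [Pi.basisFun_apply]
  have hstab : ∀ x ∈ H, ∀ v ∈ M, x.mulVec v ∈ M := by
    intro x hx v hv
    induction hv using Submodule.iSup_induction' with
    | mem j v hv =>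
      obtain ⟨y, hy, rfl⟩ := hv
      have := hM j (x * y) (mul_mem hx hy)
      rwa [← Matrix.mulVec_mulVec] at this
    | zero => simp
    | add v w _ _ hv hw =>
      rw [Matrix.mulVec_add]
      exact M.add_mem hv hw
  obtain ⟨b, hb⟩ := exists_basis_of_lattice M hfg hspan
  let A : Mat K := Matrix.of fun i j => b j i
  have hA : IsUnit A := by
    have : A = (Pi.basisFun K (Fin 2)).toMatrix b := by
      ext i j
      simp [A, Module.Basis.toMatrix_apply]
    rw [this]
    exact (Matrix.isUnit_iff_isUnit_det _).2
      ((Pi.basisFun K (Fin 2)).isUnit_det b)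
  obtain ⟨g, hg⟩ := hA
  refine ⟨g, fun x hx => ?_⟩
  have hcol : ∀ j, b j ∈ M := fun j => (hb _).2 fun i => by
    rw [b.repr_self, Finsupp.single_apply]
    split_ifs
    · exact 𝒪[K].one_mem
    · exact 𝒪[K].zero_mem
  have e : x * g.1 = g.1 * Matrix.of fun i j => b.repr (x.mulVec (b j)) i := by
    rw [hg]
    ext i j
    have := congrFun (b.sum_repr (x.mulVec (b j))) i
    rw [Matrix.mul_apply', Matrix.mul_apply]
    rw [Finset.sum_apply] at this
    refine Eq.trans (Eq.trans ?_ this.symm) (Finset.sum_congr rfl fun l _ => mul_comm _ _)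
    rfl
  rw [mem_conjOrder, mul_assoc, e, Units.inv_mul_cancel_left]
  exact fun i j => (hb _).1 (hstab x hx _ (hcol j)) i

theorem intMat_fg : (Subalgebra.toSubmodule (intMat K)).FG := by
  let φ : (Fin 2 → Fin 2 → 𝒪[K]) →ₗ[𝒪[K]] Mat K :=
    { toFun := fun f => Matrix.of fun i j => (f i j : K)
      map_add' := fun _ _ => rfl
      map_smul' := fun _ _ => rfl }
  have : Subalgebra.toSubmodule (intMat K) = (⊤ : Submodule _ _).map φ := by
    ext x
    constructor
    · exact fun hx => ⟨fun i j => ⟨x i j, hx i j⟩, trivial, rfl⟩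
    · rintro ⟨f, -, rfl⟩ i j
      exact (f i j).2
  rw [this]
  exact Submodule.FG.map _ (Module.finite_def.1 inferInstance)

theorem conjOrder_fg (g : GL (Fin 2) K) : IsOrder (conjOrder g) := by
  let φ : Mat K →ₗ[𝒪[K]] Mat K :=
    { toFun := fun y => g.1 * y * (g⁻¹ : GL (Fin 2) K).1
      map_add' := fun x y => by rw [mul_add, add_mul]
      map_smul' := fun c x => by rw [mul_smul_comm, smul_mul_assoc, RingHom.id_apply] }
  have : Subalgebra.toSubmodule (conjOrder g) = (Subalgebra.toSubmodule (intMat K)).map φ := by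
    ext x
    constructor
    · exact fun hx => ⟨_, hx, conj_conj_inv g x⟩
    · rintro ⟨y, hy, rfl⟩
      exact conj_mem_conjOrder.2 hy
  rw [IsOrder, this]
  exact Submodule.FG.map _ intMat_fg

theorem span_conjOrder (g : GL (Fin 2) K) :
    Submodule.span K (conjOrder g : Set (Mat K)) = ⊤ := by
  refine top_le_iff.1 fun x _ => ?_
  have h1 : (1 : K) ∈ 𝒪[K] := 𝒪[K].one_mem
  have h0 : (0 : K) ∈ 𝒪[K] := 𝒪[K].zero_mem
  rw [← conj_conj_inv g x]
  generalize (g⁻¹ : GL (Fin 2) K).1 * x * g.1 = y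
  have e : y = y 0 0 • !![1, 0; 0, 0] + y 0 1 • !![0, 1; 0, 0] + y 1 0 • !![0, 0; 1, 0] +
      y 1 1 • !![0, 0; 0, 1] := by
    ext i j
    fin_cases i <;> fin_cases j <;> simp
  rw [e]
  simp only [mul_add, add_mul, mul_smul_comm, smul_mul_assoc]
  refine add_mem (add_mem (add_mem ?_ ?_) ?_) ?_ <;>
  · refine Submodule.smul_mem _ _ (Submodule.subset_span (conj_mem_conjOrder.2 ?_))
    exact mem_intMat_of (by assumption) (by assumption) (by assumption) (by assumption)

theorem isFullOrder_conjOrder (g : GL (Fin 2) K) : IsFullOrder (conjOrder g) :=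
  ⟨conjOrder_fg g, span_conjOrder g⟩

theorem eq_of_conjOrder_le {g h : GL (Fin 2) K} (hle : conjOrder g ≤ conjOrder h) :
    conjOrder h = conjOrder g := by
  obtain ⟨p, hp⟩ := exists_isUnif (K := K)
  obtain ⟨n, hn⟩ := exists_relPos hp g h
  have : n ≤ 0 := (hn.forall_smul_mem_iff hp 0).1 fun x hx => by simpa using hle hx
  obtain rfl := Nat.le_zero.1 this
  exact (relPos_zero_iff.1 hn).1

/-- The maximal orders are the conjugates of `M₂(𝒪)`. -/
theorem isMaximalOrder_iff {D : Subalgebra 𝒪[K] (Mat K)} :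
    IsMaximalOrder D ↔ ∃ g, D = conjOrder g := by
  constructor
  · intro h
    obtain ⟨g, hg⟩ := exists_le_conjOrder h.1.1
    exact ⟨g, (h.eq_of_ge (isFullOrder_conjOrder g) hg).symm⟩
  · rintro ⟨g, rfl⟩
    refine ⟨isFullOrder_conjOrder g, fun R hR hle => ?_⟩
    obtain ⟨h, hh⟩ := exists_le_conjOrder hR.1
    exact eq_of_conjOrder_le (hle.trans hh) ▸ hh

end MaximalOrders

/-! ### The orders `𝒪 + p G` and vertices with three neighbours -/

section CongruenceOrder

variable {K : Type*} [Field K] [ValuativeRel K]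

/-- The order `𝒪 + p G`, for an order `G` and a uniformizer `p`. -/
def congruenceOrder {p : Kˣ} (hp : IsUnif p) (G : Subalgebra 𝒪[K] (Mat K)) :
    Subalgebra 𝒪[K] (Mat K) where
  carrier := {x | ∃ c ∈ 𝒪[K], ∃ d ∈ G, x = c • (1 : Mat K) + (p : K) • d}
  mul_mem' := by
    rintro _ _ ⟨c, hc, d, hd, rfl⟩ ⟨c', hc', d', hd', rfl⟩
    refine ⟨c * c', 𝒪[K].mul_mem hc hc', c • d' + c' • d + (p : K) • (d * d'),
      G.add_mem (G.add_mem (smul_mem_of_mem hc hd') (smul_mem_of_mem hc' hd))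
        (smul_mem_of_mem hp.mem (G.mul_mem hd hd')), ?_⟩
    simp only [add_mul, mul_add, smul_mul_assoc, mul_smul_comm, one_mul, mul_one, smul_add,
      smul_smul]
    rw [mul_comm c' c, mul_comm (p : K) c, mul_comm (p : K) c']
    abel
  add_mem' := by
    rintro _ _ ⟨c, hc, d, hd, rfl⟩ ⟨c', hc', d', hd', rfl⟩
    refine ⟨c + c', 𝒪[K].add_mem hc hc', d + d', G.add_mem hd hd', ?_⟩
    rw [add_smul, smul_add]
    abel
  algebraMap_mem' := by
    intro r
    refine ⟨r, r.2, 0, G.zero_mem, ?_⟩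
    rw [smul_zero, add_zero]
    exact Algebra.algebraMap_eq_smul_one r

variable {p : Kˣ} (hp : IsUnif p)

theorem congruenceOrder_mono {G G' : Subalgebra 𝒪[K] (Mat K)} (h : G ≤ G') :
    congruenceOrder hp G ≤ congruenceOrder hp G' := by
  rintro _ ⟨c, hc, d, hd, rfl⟩
  exact ⟨c, hc, d, h hd, rfl⟩

theorem congruenceOrder_le (G : Subalgebra 𝒪[K] (Mat K)) : congruenceOrder hp G ≤ G := by
  rintro _ ⟨c, hc, d, hd, rfl⟩
  exact G.add_mem (smul_mem_of_mem hc G.one_mem) (smul_mem_of_mem hp.mem hd)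

theorem mem_congruenceOrder_conjOrder {g : GL (Fin 2) K} {y : Mat K} :
    g.1 * y * (g⁻¹ : GL (Fin 2) K).1 ∈ congruenceOrder hp (conjOrder g) ↔
      y ∈ intMat K ∧ (p : K)⁻¹ * y 0 1 ∈ 𝒪[K] ∧ (p : K)⁻¹ * y 1 0 ∈ 𝒪[K] ∧
        (p : K)⁻¹ * (y 1 1 - y 0 0) ∈ 𝒪[K] := by
  have hp0 := p.ne_zero
  constructor
  · rintro ⟨c, hc, d, hd, e⟩
    rw [mem_conjOrder] at hd
    have e' : y = c • (1 : Mat K) + (p : K) • ((g⁻¹ : GL (Fin 2) K).1 * d * g.1) := by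
      rw [← conj_inv_conj g y, e, mul_add, add_mul]
      simp
    generalize (g⁻¹ : GL (Fin 2) K).1 * d * g.1 = z at *
    subst e'
    refine ⟨(intMat K).add_mem (smul_mem_of_mem hc (one_mem _)) (smul_mem_of_mem hp.mem hd),
      ?_, ?_, ?_⟩
    · simpa [hp0] using hd 0 1
    · simpa [hp0] using hd 1 0
    · have := 𝒪[K].sub_mem (hd 1 1) (hd 0 0)
      simpa [← mul_sub, hp0] using this
  · rintro ⟨hy, h1, h2, h3⟩
    refine ⟨y 0 0, hy 0 0, _, conj_mem_conjOrder.2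
      (mem_intMat_of 𝒪[K].zero_mem h1 h2 h3), ?_⟩
    have e : y = y 0 0 • (1 : Mat K) +
        (p : K) • !![0, (p : K)⁻¹ * y 0 1; (p : K)⁻¹ * y 1 0, (p : K)⁻¹ * (y 1 1 - y 0 0)] := by
      ext i j
      fin_cases i <;> fin_cases j <;> simp [hp0]
    nth_rw 1 [e]
    rw [mul_add, add_mul, mul_smul_comm, mul_smul_comm, smul_mul_assoc, smul_mul_assoc, mul_one,
      Units.mul_inv]

variable [IsDiscreteValuationRing 𝒪[K]]

theorem isFullOrder_congruenceOrder {G : Subalgebra 𝒪[K] (Mat K)} (hG : IsFullOrder G) :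
    IsFullOrder (congruenceOrder hp G) := by
  constructor
  · have : Module.Finite 𝒪[K] (Subalgebra.toSubmodule G) := Module.Finite.iff_fg.2 hG.1
    have : IsNoetherian 𝒪[K] (Subalgebra.toSubmodule G) :=
      isNoetherian_of_isNoetherianRing_of_finite _ _
    have hle : Subalgebra.toSubmodule (congruenceOrder hp G) ≤ Subalgebra.toSubmodule G :=
      congruenceOrder_le hp G
    have := isNoetherian_of_le hle
    exact Module.Finite.iff_fg.1 inferInstance
  · rw [← top_le_iff, ← hG.2, Submodule.span_le]
    intro x hx
    have : (p : K) • x ∈ congruenceOrder hp G := ⟨0, 𝒪[K].zero_mem, x, hx, by simp⟩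
    rw [SetLike.mem_coe, ← inv_smul_smul₀ p.ne_zero x]
    exact Submodule.smul_mem _ _ (Submodule.subset_span this)

end CongruenceOrder

/-- The binary quadratic form `det (v, y v)` of a matrix `y`, at the vector `v = (a, c)`. Its zeros are
the eigenlines of `y`. -/
def eigenForm {K : Type*} [Field K] (y : Mat K) (a c : K) : K :=
  y 1 0 * a ^ 2 + (y 1 1 - y 0 0) * (a * c) - y 0 1 * c ^ 2

section Neighbours

variable {K : Type*} [Field K] [ValuativeRel K] {p : Kˣ} (hp : IsUnif p)
include hp

/-- `k diag(1, p) M₂(𝒪) diag(1, p)⁻¹ k⁻¹` contains an integral matrix `y` if and only if the first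
column of `k` spans, modulo `p`, an eigenline of `y`. -/
theorem mem_conjOrder_mul_diagGL_iff {k : GL (Fin 2) K} (hk : k ∈ intGL K) {y : Mat K}
    (hy : y ∈ intMat K) : y ∈ conjOrder (k * diagGL p) ↔
      (p : K)⁻¹ * eigenForm y (k.1 0 0) (k.1 1 0) ∈ 𝒪[K] := by
  have hz := (intMat K).mul_mem ((intMat K).mul_mem hk.2 hy) hk.1
  have hdet := det_unit_ne_zero k
  have e : eigenForm y (k.1 0 0) (k.1 1 0) =
      k.1.det * ((k⁻¹ : GL (Fin 2) K).1 * y * k.1) 1 0 := by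
    rw [Matrix.coe_units_inv, Matrix.inv_def, Ring.inverse_eq_inv', smul_mul_assoc, smul_mul_assoc,
      Matrix.smul_apply, smul_eq_mul, mul_inv_cancel_left₀ hdet, Matrix.adjugate_fin_two]
    simp only [eigenForm, Matrix.mul_apply, Fin.sum_univ_two, Matrix.of_apply, Matrix.cons_val',
      Matrix.cons_val_zero, Matrix.cons_val_one, Matrix.cons_val_fin_one]
    ring
  have e' : ((k⁻¹ : GL (Fin 2) K).1 * y * k.1) 1 0 =
      (k.1.det)⁻¹ * eigenForm y (k.1 0 0) (k.1 1 0) := by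
    rw [e, inv_mul_cancel_left₀ hdet]
  rw [mem_conjOrder_mul, mem_conjOrder_diagGL]
  constructor
  · rintro ⟨-, -, h, -⟩
    rw [e, mul_left_comm]
    exact 𝒪[K].mul_mem (det_mem_of_mem_intMat hk.1) h
  · intro h
    refine ⟨hz _ _, 𝒪[K].mul_mem hp.mem (hz _ _), ?_, hz _ _⟩
    rw [e', mul_left_comm]
    exact 𝒪[K].mul_mem (det_inv_mem_of_mem_intGL hk) h

/-- Neighbours given by the same line modulo `p` agree. -/
theorem conjOrder_mul_diagGL_congr {k k' : GL (Fin 2) K} (hk : k ∈ intGL K) (hk' : k' ∈ intGL K)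
    (h : (p : K)⁻¹ * (k.1 0 0 * k'.1 1 0 - k'.1 0 0 * k.1 1 0) ∈ 𝒪[K]) :
    conjOrder (k' * diagGL p) = conjOrder (k * diagGL p) := by
  have hz : (k⁻¹ * k') ∈ intGL K := mul_mem (inv_mem hk) hk'
  have hdet := det_unit_ne_zero k
  have e : (k⁻¹ * k').1 1 0 = (k.1.det)⁻¹ * (k.1 0 0 * k'.1 1 0 - k'.1 0 0 * k.1 1 0) := by
    rw [Units.val_mul, Matrix.coe_units_inv, Matrix.inv_def, Ring.inverse_eq_inv', smul_mul_assoc,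
      Matrix.smul_apply, smul_eq_mul, Matrix.adjugate_fin_two]
    simp only [Matrix.mul_apply, Fin.sum_univ_two, Matrix.of_apply, Matrix.cons_val',
      Matrix.cons_val_zero, Matrix.cons_val_one, Matrix.cons_val_fin_one]
    ring
  have hu : (diagGL p)⁻¹ * (k⁻¹ * k') * diagGL p ∈ intGL K := by
    apply mem_intGL_of_det
    · rw [Units.val_mul, Units.val_mul, conj_diagGL, e]
      refine mem_intMat_of (hz.1 _ _) (𝒪[K].mul_mem hp.mem (hz.1 _ _)) ?_ (hz.1 _ _)
      rw [mul_left_comm]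
      exact 𝒪[K].mul_mem (det_inv_mem_of_mem_intGL hk) h
    · have : ((diagGL p)⁻¹ * (k⁻¹ * k') * diagGL p).1.det = (k⁻¹ * k').1.det := by
        rw [Units.val_mul, Units.val_mul _ (k⁻¹ * k'), Matrix.det_mul, Matrix.det_mul, mul_comm,
          ← mul_assoc, ← Matrix.det_mul, Units.mul_inv, Matrix.det_one, one_mul]
      rw [this]
      exact det_inv_mem_of_mem_intGL hz
  rw [← conjOrder_mul_of_mem_intGL (k * diagGL p) hu]
  congr 1
  group

omit hp in
/-- A binary quadratic form with three different zeros on the projective line vanishes. Here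
`d₁₂`, `d₁₃`, `d₂₃` are the determinants that tell the zeros apart. -/
theorem quadratic_form_coeffs {A B C a₁ c₁ a₂ c₂ a₃ c₃ : K} {d₁₂ d₁₃ d₂₃ : K}
    (h₁₂ : d₁₂ = a₁ * c₂ - a₂ * c₁) (h₁₃ : d₁₃ = a₁ * c₃ - a₃ * c₁)
    (h₂₃ : d₂₃ = a₂ * c₃ - a₃ * c₂) :
    let q := fun a c => A * a ^ 2 + B * (a * c) - C * c ^ 2
    d₁₂ * d₁₃ * d₂₃ * A =
        c₂ * c₃ * d₂₃ * q a₁ c₁ - c₁ * c₃ * d₁₃ * q a₂ c₂ + c₁ * c₂ * d₁₂ * q a₃ c₃ ∧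
      d₁₂ * d₁₃ * d₂₃ * B =
        -((a₂ * c₃ + a₃ * c₂) * d₂₃ * q a₁ c₁ - (a₁ * c₃ + a₃ * c₁) * d₁₃ * q a₂ c₂ +
          (a₁ * c₂ + a₂ * c₁) * d₁₂ * q a₃ c₃) ∧
      d₁₂ * d₁₃ * d₂₃ * C =
        -(a₂ * a₃ * d₂₃ * q a₁ c₁ - a₁ * a₃ * d₁₃ * q a₂ c₂ + a₁ * a₂ * d₁₂ * q a₃ c₃) := by
  subst h₁₂ h₁₃ h₂₃
  refine ⟨?_, ?_, ?_⟩ <;> ring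

variable [IsDiscreteValuationRing 𝒪[K]]

/-- An order contained in a vertex and in three of its neighbours is scalar modulo `p` there: its
elements have three eigenlines in the plane over the residue field. -/
theorem le_congruenceOrder {H : Subalgebra 𝒪[K] (Mat K)} {g : GL (Fin 2) K}
    (hH : H ≤ conjOrder g) {D₁ D₂ D₃ : Subalgebra 𝒪[K] (Mat K)}
    (h₁ : RelPos p 1 (conjOrder g) D₁) (h₂ : RelPos p 1 (conjOrder g) D₂)
    (h₃ : RelPos p 1 (conjOrder g) D₃) (hH₁ : H ≤ D₁) (hH₂ : H ≤ D₂) (hH₃ : H ≤ D₃)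
    (h₁₂ : D₁ ≠ D₂) (h₁₃ : D₁ ≠ D₃) (h₂₃ : D₂ ≠ D₃) :
    H ≤ congruenceOrder hp (conjOrder g) := by
  obtain ⟨k₁, hk₁, rfl⟩ := relPos_one_conjOrder_iff.1 h₁
  obtain ⟨k₂, hk₂, rfl⟩ := relPos_one_conjOrder_iff.1 h₂
  obtain ⟨k₃, hk₃, rfl⟩ := relPos_one_conjOrder_iff.1 h₃
  have key : ∀ k ∈ intGL K, ∀ k' ∈ intGL K,
      conjOrder (g * (k * diagGL p)) ≠ conjOrder (g * (k' * diagGL p)) →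
      k.1 0 0 * k'.1 1 0 - k'.1 0 0 * k.1 1 0 ≠ 0 ∧
      (k.1 0 0 * k'.1 1 0 - k'.1 0 0 * k.1 1 0)⁻¹ ∈ 𝒪[K] := by
    intro k hk k' hk' hne
    refine (hp.inv_mem_or (𝒪[K].sub_mem (𝒪[K].mul_mem (hk.1 _ _) (hk'.1 _ _))
      (𝒪[K].mul_mem (hk'.1 _ _) (hk.1 _ _)))).resolve_right fun h => hne ?_
    exact (conjOrder_congr g (conjOrder_mul_diagGL_congr hp hk hk' h)).symm
  obtain ⟨n₁₂, i₁₂⟩ := key k₁ hk₁ k₂ hk₂ h₁₂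
  obtain ⟨n₁₃, i₁₃⟩ := key k₁ hk₁ k₃ hk₃ h₁₃
  obtain ⟨n₂₃, i₂₃⟩ := key k₂ hk₂ k₃ hk₃ h₂₃
  intro x hx
  have hy : (g⁻¹ : GL (Fin 2) K).1 * x * g.1 ∈ intMat K := hH hx
  have hq : ∀ k ∈ intGL K, H ≤ conjOrder (g * (k * diagGL p)) →
      (p : K)⁻¹ * eigenForm ((g⁻¹ : GL (Fin 2) K).1 * x * g.1) (k.1 0 0) (k.1 1 0) ∈ 𝒪[K] :=
    fun k hk hle => (mem_conjOrder_mul_diagGL_iff hp hk hy).1 (mem_conjOrder_mul.1 (hle hx))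
  have q₁ := hq k₁ hk₁ hH₁
  have q₂ := hq k₂ hk₂ hH₂
  have q₃ := hq k₃ hk₃ hH₃
  rw [← conj_conj_inv g x]
  generalize (g⁻¹ : GL (Fin 2) K).1 * x * g.1 = y at *
  rw [mem_congruenceOrder_conjOrder]
  obtain ⟨eA, eB, eC⟩ := quadratic_form_coeffs (A := y 1 0) (B := y 1 1 - y 0 0) (C := y 0 1)
    (a₁ := k₁.1 0 0) (c₁ := k₁.1 1 0) (a₂ := k₂.1 0 0) (c₂ := k₂.1 1 0)
    (a₃ := k₃.1 0 0) (c₃ := k₃.1 1 0) rfl rfl rfl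
  simp only [eigenForm] at q₁ q₂ q₃
  have ha₁ := hk₁.1 0 0
  have ha₂ := hk₂.1 0 0
  have ha₃ := hk₃.1 0 0
  have hc₁ := hk₁.1 1 0
  have hc₂ := hk₂.1 1 0
  have hc₃ := hk₃.1 1 0
  generalize k₁.1 0 0 = a₁ at *
  generalize k₂.1 0 0 = a₂ at *
  generalize k₃.1 0 0 = a₃ at *
  generalize k₁.1 1 0 = c₁ at *
  generalize k₂.1 1 0 = c₂ at *
  generalize k₃.1 1 0 = c₃ at *
  have d₁₂ := 𝒪[K].sub_mem (𝒪[K].mul_mem ha₁ hc₂) (𝒪[K].mul_mem ha₂ hc₁)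
  have d₁₃ := 𝒪[K].sub_mem (𝒪[K].mul_mem ha₁ hc₃) (𝒪[K].mul_mem ha₃ hc₁)
  have d₂₃ := 𝒪[K].sub_mem (𝒪[K].mul_mem ha₂ hc₃) (𝒪[K].mul_mem ha₃ hc₂)
  generalize a₁ * c₂ - a₂ * c₁ = e₁₂ at *
  generalize a₁ * c₃ - a₃ * c₁ = e₁₃ at *
  generalize a₂ * c₃ - a₃ * c₂ = e₂₃ at *
  have aux : ∀ X α β γ r s t : K, α ∈ 𝒪[K] → β ∈ 𝒪[K] → γ ∈ 𝒪[K] → (p : K)⁻¹ * r ∈ 𝒪[K] →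
      (p : K)⁻¹ * s ∈ 𝒪[K] → (p : K)⁻¹ * t ∈ 𝒪[K] →
      e₁₂ * e₁₃ * e₂₃ * X = α * r + β * s + γ * t → (p : K)⁻¹ * X ∈ 𝒪[K] := by
    intro X α β γ r s t hα hβ hγ hr hs ht e
    have : (p : K)⁻¹ * X = e₁₂⁻¹ * e₁₃⁻¹ * e₂₃⁻¹ * (α * ((p : K)⁻¹ * r) + β * ((p : K)⁻¹ * s) +
        γ * ((p : K)⁻¹ * t)) := by
      have hX : X = e₁₂⁻¹ * e₁₃⁻¹ * e₂₃⁻¹ * (α * r + β * s + γ * t) := by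
        rw [← e]
        field_simp
      rw [hX]
      ring
    rw [this]
    exact 𝒪[K].mul_mem (𝒪[K].mul_mem (𝒪[K].mul_mem i₁₂ i₁₃) i₂₃) (𝒪[K].add_mem (𝒪[K].add_mem
      (𝒪[K].mul_mem hα hr) (𝒪[K].mul_mem hβ hs)) (𝒪[K].mul_mem hγ ht))
  have M := fun {a b : K} (ha : a ∈ 𝒪[K]) (hb : b ∈ 𝒪[K]) => 𝒪[K].mul_mem ha hb
  have S := fun {a b : K} (ha : a ∈ 𝒪[K]) (hb : b ∈ 𝒪[K]) => 𝒪[K].add_mem ha hb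
  have N := fun {a : K} (ha : a ∈ 𝒪[K]) => 𝒪[K].neg_mem ha
  refine ⟨hy, aux _ _ _ _ _ _ _ (N (M (M ha₂ ha₃) d₂₃)) (M (M ha₁ ha₃) d₁₃)
      (N (M (M ha₁ ha₂) d₁₂)) q₁ q₂ q₃ (eC.trans (by ring)),
    aux _ _ _ _ _ _ _ (M (M hc₂ hc₃) d₂₃) (N (M (M hc₁ hc₃) d₁₃)) (M (M hc₁ hc₂) d₁₂) q₁ q₂ q₃
      (eA.trans (by ring)),
    aux _ _ _ _ _ _ _ (N (M (S (M ha₂ hc₃) (M ha₃ hc₂)) d₂₃)) (M (S (M ha₁ hc₃) (M ha₃ hc₁)) d₁₃)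
      (N (M (S (M ha₁ hc₂) (M ha₂ hc₁)) d₁₂)) q₁ q₂ q₃ (eB.trans (by ring))⟩

/-- Every vertex has three neighbours that contain `𝒪 + p D`, namely those given by the lines
spanned by `(1, 0)`, `(0, 1)` and `(1, 1)`. -/
theorem exists_three_neighbours (g : GL (Fin 2) K) :
    ∃ D : Fin 3 → Subalgebra 𝒪[K] (Mat K), Function.Injective D ∧
      ∀ i, RelPos p 1 (conjOrder g) (D i) ∧ congruenceOrder hp (conjOrder g) ≤ D i := by
  have m1 : (1 : K) ∈ 𝒪[K] := 𝒪[K].one_mem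
  have m0 : (0 : K) ∈ 𝒪[K] := 𝒪[K].zero_mem
  let k : Fin 3 → GL (Fin 2) K :=
    ![1, mkGL 0 1 1 0 (by simp), mkGL 1 0 1 1 (by simp)]
  have hk : ∀ i, k i ∈ intGL K := by
    have h₁ : mkGL (0 : K) 1 1 0 (by simp) ∈ intGL K := by
      refine mkGL_mem_intGL _ m0 m1 m1 m0 ?_
      simp only [mul_zero, zero_sub, mul_one, inv_neg, inv_one]
      exact 𝒪[K].neg_mem m1
    have h₂ : mkGL (1 : K) 0 1 1 (by simp) ∈ intGL K := mkGL_mem_intGL _ m1 m0 m1 m1 (by simp)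
    intro i
    fin_cases i
    exacts [one_mem _, h₁, h₂]
  have hmem : ∀ i, ∀ y ∈ intMat K, g.1 * y * (g⁻¹ : GL (Fin 2) K).1 ∈
      conjOrder (g * (k i * diagGL p)) ↔
      (p : K)⁻¹ * eigenForm y ((k i).1 0 0) ((k i).1 1 0) ∈ 𝒪[K] := by
    intro i y hy
    rw [conj_mem_conjOrder_mul, mem_conjOrder_mul_diagGL_iff hp (hk i) hy]
  refine ⟨fun i => conjOrder (g * (k i * diagGL p)), ?_, fun i => ⟨?_, ?_⟩⟩
  · -- the nilpotent matrices with a given eigenline tell the neighbours apart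
    have u : (!![0, 1; 0, 0] : Mat K) ∈ intMat K := mem_intMat_of m0 m1 m0 m0
    have l : (!![0, 0; 1, 0] : Mat K) ∈ intMat K := mem_intMat_of m0 m0 m1 m0
    have hn : -(p : K)⁻¹ ∉ 𝒪[K] := fun h => hp.inv_notMem (by simpa using 𝒪[K].neg_mem h)
    have hn' := hp.inv_notMem
    intro i j hij
    have hij' : ∀ x, x ∈ conjOrder (g * (k i * diagGL p)) ↔ x ∈ conjOrder (g * (k j * diagGL p)) :=
      SetLike.ext_iff.1 hij
    have hu := hij' (g.1 * !![0, 1; 0, 0] * (g⁻¹ : GL (Fin 2) K).1)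
    have hl := hij' (g.1 * !![0, 0; 1, 0] * (g⁻¹ : GL (Fin 2) K).1)
    rw [hmem i _ u, hmem j _ u] at hu
    rw [hmem i _ l, hmem j _ l] at hl
    fin_cases i <;> fin_cases j <;>
      simp [k, eigenForm, coe_mkGL, hn, hn', m0] at hu hl ⊢
  · exact relPos_one_conjOrder_iff.2 ⟨k i, hk i, rfl⟩
  · intro x hx
    rw [← conj_conj_inv g x] at hx ⊢
    generalize (g⁻¹ : GL (Fin 2) K).1 * x * g.1 = y at *
    rw [mem_congruenceOrder_conjOrder] at hx
    obtain ⟨hy, h01, h10, hd⟩ := hx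
    rw [hmem i y hy]
    have e : ∀ a c : K, (p : K)⁻¹ * eigenForm y a c = (p : K)⁻¹ * y 1 0 * a ^ 2 +
        (p : K)⁻¹ * (y 1 1 - y 0 0) * (a * c) - (p : K)⁻¹ * y 0 1 * c ^ 2 := by
      intro a c
      rw [eigenForm]
      ring
    rw [e]
    have ha := (hk i).1 0 0
    have hc := (hk i).1 1 0
    exact 𝒪[K].sub_mem (𝒪[K].add_mem (𝒪[K].mul_mem h10 (𝒪[K].pow_mem ha 2))
      (𝒪[K].mul_mem hd (𝒪[K].mul_mem ha hc))) (𝒪[K].mul_mem h01 (𝒪[K].pow_mem hc 2))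

end Neighbours

/-! ### The orders `𝒪 + p M₂(𝒪)` are not Gorenstein -/

section NotGorenstein

variable {K : Type*} [Field K] [ValuativeRel K] {p : Kˣ} (hp : IsUnif p)
include hp

/-- Let `D = g M₂(𝒪) g⁻¹`. The codifferent `C` lies in `p⁻¹ D` and contains `p⁻¹` times the traceless
elements of `D`. Multiplying an inverse `J` of `C` with these shows `J ⊆ p² D`; so `1 ∉ C J`. -/
theorem not_isGorenstein_congruenceOrder (g : GL (Fin 2) K) :
    ¬ IsGorenstein (congruenceOrder hp (conjOrder g)) := by
  rintro ⟨-, -, J, -, hCJ, hJC⟩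
  have hp0 := p.ne_zero
  have m1 : (1 : K) ∈ 𝒪[K] := 𝒪[K].one_mem
  have m0 : (0 : K) ∈ 𝒪[K] := 𝒪[K].zero_mem
  have htr : ∀ y : Mat K, Matrix.trace (g.1 * y * (g⁻¹ : GL (Fin 2) K).1) = Matrix.trace y := by
    intro y
    rw [Matrix.trace_mul_comm, Units.inv_mul_cancel_left]
  have hC : ∀ a ∈ codiff (congruenceOrder hp (conjOrder g)),
      (p : K) • ((g⁻¹ : GL (Fin 2) K).1 * a * g.1) ∈ intMat K := by
    intro a ha i j
    have hE : g.1 * ((p : K) • Matrix.single j i 1) * (g⁻¹ : GL (Fin 2) K).1 ∈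
        congruenceOrder hp (conjOrder g) := by
      refine ⟨0, m0, g.1 * Matrix.single j i 1 * (g⁻¹ : GL (Fin 2) K).1,
        conj_mem_conjOrder.2 fun a b => ?_, ?_⟩
      · rw [Matrix.single_apply]
        split_ifs
        · exact m1
        · exact m0
      · rw [zero_smul, zero_add, mul_smul_comm, smul_mul_assoc]
    have := ha _ hE
    nth_rw 1 [← conj_conj_inv g a] at this
    have e : ∀ y z : Mat K, g.1 * y * (g⁻¹ : GL (Fin 2) K).1 * (g.1 * z * (g⁻¹ : GL (Fin 2) K).1) =
        g.1 * (y * z) * (g⁻¹ : GL (Fin 2) K).1 := by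
      intro y z
      simp only [mul_assoc, Units.inv_mul_cancel_left]
    rw [e, htr, mul_smul_comm, Matrix.trace_smul, Matrix.trace_mul_single] at this
    simpa using this
  have hC' : ∀ z ∈ intMat K, Matrix.trace z = 0 →
      g.1 * ((p : K)⁻¹ • z) * (g⁻¹ : GL (Fin 2) K).1 ∈
        codiff (congruenceOrder hp (conjOrder g)) := by
    rintro z hz hz0 _ ⟨c, hc, d, hd, rfl⟩
    rw [mem_conjOrder] at hd
    have e : g.1 * ((p : K)⁻¹ • z) * (g⁻¹ : GL (Fin 2) K).1 * (c • (1 : Mat K) + (p : K) • d) =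
        g.1 * ((c * (p : K)⁻¹) • z + z * ((g⁻¹ : GL (Fin 2) K).1 * d * g.1)) *
          (g⁻¹ : GL (Fin 2) K).1 := by
      simp only [mul_add, add_mul, mul_smul_comm, smul_mul_assoc, mul_one, smul_smul,
        mul_inv_cancel₀ hp0, one_smul, mul_assoc, Units.mul_inv]
    rw [e, htr, Matrix.trace_add, Matrix.trace_smul, hz0, smul_zero, zero_add]
    have := (intMat K).mul_mem hz hd
    rw [Matrix.trace_fin_two]
    exact 𝒪[K].add_mem (this _ _) (this _ _)
  have hJ : ∀ j ∈ J, ∀ a b, (p : K)⁻¹ * ((p : K)⁻¹ * ((g⁻¹ : GL (Fin 2) K).1 * j * g.1) a b) ∈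
      𝒪[K] := by
    intro j hj
    have key : ∀ z ∈ intMat K, Matrix.trace z = 0 →
        g.1 * ((p : K)⁻¹ • (((g⁻¹ : GL (Fin 2) K).1 * j * g.1) * z)) * (g⁻¹ : GL (Fin 2) K).1 ∈
          congruenceOrder hp (conjOrder g) := by
      intro z hz hz0
      have := Submodule.mul_mem_mul hj (hC' z hz hz0)
      rw [hJC] at this
      have e : g.1 * ((p : K)⁻¹ • (((g⁻¹ : GL (Fin 2) K).1 * j * g.1) * z)) *
          (g⁻¹ : GL (Fin 2) K).1 = j * (g.1 * ((p : K)⁻¹ • z) * (g⁻¹ : GL (Fin 2) K).1) := by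
        simp only [mul_smul_comm, smul_mul_assoc, mul_assoc, Units.mul_inv_cancel_left]
      rw [e]
      exact this
    generalize (g⁻¹ : GL (Fin 2) K).1 * j * g.1 = w at *
    have h1 := (mem_congruenceOrder_conjOrder hp).1
      (key !![0, 1; 0, 0] (mem_intMat_of m0 m1 m0 m0) (by simp [Matrix.trace_fin_two]))
    have h2 := (mem_congruenceOrder_conjOrder hp).1
      (key !![0, 0; 1, 0] (mem_intMat_of m0 m0 m1 m0) (by simp [Matrix.trace_fin_two]))
    obtain ⟨-, a1, -, a3⟩ := h1
    obtain ⟨-, -, b2, b3⟩ := h2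
    simp only [Matrix.smul_apply, smul_eq_mul, Matrix.mul_apply, Fin.sum_univ_two, Matrix.of_apply,
      Matrix.cons_val', Matrix.cons_val_zero, Matrix.cons_val_one, Matrix.cons_val_fin_one,
      mul_zero, mul_one, add_zero, zero_add, sub_zero, zero_sub, mul_neg] at a1 a3 b2 b3
    intro a b
    fin_cases a <;> fin_cases b
    · exact a1
    · simpa using 𝒪[K].neg_mem b3
    · exact a3
    · exact b2
  have hprod : ∀ x ∈ codiff (congruenceOrder hp (conjOrder g)) * J,
      (p : K)⁻¹ • ((g⁻¹ : GL (Fin 2) K).1 * x * g.1) ∈ intMat K := by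
    intro x hx
    induction hx using Submodule.mul_induction_on' with
    | mem_mul_mem a ha j hj =>
      have h2 : (p : K)⁻¹ • (p : K)⁻¹ • ((g⁻¹ : GL (Fin 2) K).1 * j * g.1) ∈ intMat K := hJ j hj
      have := (intMat K).mul_mem (hC a ha) h2
      simp only [mul_smul_comm, smul_mul_assoc, mul_assoc, Units.mul_inv_cancel_left,
        inv_smul_smul₀ hp0] at this
      simpa only [mul_assoc] using this
    | add x _ y _ hx hy =>
      rw [mul_add, add_mul, smul_add]
      exact (intMat K).add_mem hx hy
  have h1 := hprod 1 (by rw [hCJ]; exact one_mem (congruenceOrder hp (conjOrder g)))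
  rw [mul_one, Units.inv_mul] at h1
  exact hp.inv_notMem (by simpa using h1 0 0)

end NotGorenstein

/-! ### Recognizing lines among graphs -/

section Lines

theorem realLine_adj {m n : ℤ} : realLine.Adj m n ↔ n = m + 1 ∨ m = n + 1 := by
  rw [realLine, SimpleGraph.hasse_adj, Order.covBy_iff_add_one_eq, Order.covBy_iff_add_one_eq]
  exact or_congr eq_comm eq_comm

variable {V : Type*} {G : SimpleGraph V}

theorem exists_iso_realLine (hG : G.Connected) (f : V → ℤ) (hf : Function.Injective f)
    (hadj : ∀ w w', G.Adj w w' ↔ f w' = f w + 1 ∨ f w = f w' + 1) :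
    ∃ I : Set ℤ, (realLine.induce I).Connected ∧ Nonempty (G ≃g realLine.induce I) := by
  let e : G ↪g realLine := ⟨⟨f, hf⟩, fun {a b} => realLine_adj.trans (hadj a b).symm⟩
  exact ⟨Set.range e, e.isoInduceRange.connected_iff.1 hG, ⟨e.isoInduceRange⟩⟩

/-- A rooted tree in which no vertex has three neighbours is a line. The tree structure is given by
the distance `l` to the root `v`. The vertices above the chosen neighbour `a` of `v` are placed on
the positive half-line and all others on the negative one. -/
theorem exists_iso_realLine_of_level (v : V) (l : V → ℕ) (h0 : ∀ w, l w = 0 ↔ w = v)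
    (hadj : ∀ w w', G.Adj w w' → l w' = l w + 1 ∨ l w = l w' + 1)
    (hpar : ∀ w n, l w = n + 1 → ∃ q, G.Adj w q ∧ l q = n)
    (huniq : ∀ w q q', G.Adj w q → G.Adj w q' → l w = l q + 1 → l w = l q' + 1 → q = q')
    (hdeg : ∀ w a b c, G.Adj w a → G.Adj w b → G.Adj w c → a = b ∨ a = c ∨ b = c) :
    ∃ I : Set ℤ, (realLine.induce I).Connected ∧ Nonempty (G ≃g realLine.induce I) := by
  have hreach : ∀ n w, l w = n → G.Reachable w v := by
    intro n
    induction n with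
    | zero =>
      intro w hw
      rw [(h0 w).1 hw]
    | succ n ih =>
      intro w hw
      obtain ⟨q, hq, hq'⟩ := hpar w n hw
      exact hq.reachable.trans (ih q hq')
  have hconn : G.Connected :=
    { preconnected := fun w w' => (hreach _ w rfl).trans (hreach _ w' rfl).symm
      nonempty := ⟨v⟩ }
  by_cases hne : ∃ a, G.Adj v a
  swap
  · have hv : ∀ w, w = v := by
      intro w
      by_contra hw
      obtain ⟨n, hn⟩ : ∃ n, l w = n + 1 :=
        Nat.exists_eq_succ_of_ne_zero fun h => hw ((h0 w).1 h)
      clear hw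
      induction n generalizing w with
      | zero =>
        obtain ⟨q, hq, hq'⟩ := hpar w 0 hn
        rw [(h0 q).1 hq'] at hq
        exact hne ⟨w, hq.symm⟩
      | succ n ih =>
        obtain ⟨q, -, hq'⟩ := hpar w _ hn
        exact ih q hq'
    refine exists_iso_realLine hconn (fun _ => 0) (fun a b _ => (hv a).trans (hv b).symm) ?_
    intro w w'
    rw [hv w, hv w']
    simp
  obtain ⟨a, ha⟩ := hne
  have hlv : l v = 0 := (h0 v).2 rfl
  have hla : l a = 1 := by
    rcases hadj v a ha with h | h <;> omega
  let S : V → Prop := Relation.ReflTransGen (fun x y => G.Adj x y ∧ l y = l x + 1) a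
  have hSl : ∀ w, S w → 1 ≤ l w := by
    intro w hw
    induction hw with
    | refl => exact hla.ge
    | tail _ h _ => omega
  have hSstep : ∀ w q, G.Adj w q → l w = l q + 1 → l q ≠ 0 → (S w ↔ S q) := by
    intro w q hwq hl hq
    constructor
    · intro hw
      rcases Relation.ReflTransGen.cases_tail hw with h | ⟨b, hb, hbw, hbl⟩
      · subst h
        omega
      · exact huniq w b q hbw.symm hwq hbl hl ▸ hb
    · intro hS
      exact Relation.ReflTransGen.tail hS ⟨hwq.symm, hl⟩
  have hS1 : ∀ w, l w = 1 → (S w ↔ w = a) := by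
    intro w hl
    constructor
    · intro hw
      rcases Relation.ReflTransGen.cases_tail hw with h | ⟨b, hb, -, hbl⟩
      · exact h
      · have := hSl b hb
        omega
    · rintro rfl
      exact Relation.ReflTransGen.refl
  have hlev : ∀ n w w', l w = n + 1 → l w' = n + 1 → (S w ↔ S w') → w = w' := by
    intro n
    induction n with
    | zero =>
      intro w w' hw hw' hS
      rw [hS1 w hw, hS1 w' hw'] at hS
      obtain ⟨q, hq, hq0⟩ := hpar w 0 hw
      obtain ⟨q', hq', hq0'⟩ := hpar w' 0 hw'
      rw [(h0 _).1 hq0] at hq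
      rw [(h0 _).1 hq0'] at hq'
      rcases hdeg v a w w' ha hq.symm hq'.symm with h | h | h
      · rw [← h, eq_comm, ← hS, h]
      · rw [← h, hS, h]
      · exact h
    | succ n ih =>
      intro w w' hw hw' hS
      obtain ⟨q, hq, hql⟩ := hpar w _ hw
      obtain ⟨q', hq', hql'⟩ := hpar w' _ hw'
      have e := ih q q' hql hql' (by
        rw [← hSstep w q hq (by omega) (by omega), ← hSstep w' q' hq' (by omega) (by omega), hS])
      subst e
      obtain ⟨r, hr, hrl⟩ := hpar q n hql
      rcases hdeg q r w w' hr hq.symm hq'.symm with h | h | h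
      · subst h
        omega
      · subst h
        omega
      · exact h
  classical
  let f : V → ℤ := fun w => if S w then l w else -l w
  have hfS : ∀ w, S w → f w = l w := fun w h => if_pos h
  have hfN : ∀ w, ¬ S w → f w = -l w := fun w h => if_neg h
  have hinj : Function.Injective f := by
    intro w w' hf
    have pos := hSl w
    have pos' := hSl w'
    by_cases hw : S w <;> by_cases hw' : S w'
    · rw [hfS w hw, hfS w' hw'] at hf
      have := pos hw
      exact hlev (l w - 1) w w' (by omega) (by omega) (by tauto)
    · rw [hfS w hw, hfN w' hw'] at hf
      have := pos hw
      omega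
    · rw [hfN w hw, hfS w' hw'] at hf
      have := pos' hw'
      omega
    · rw [hfN w hw, hfN w' hw'] at hf
      by_cases hz : l w = 0
      · rw [(h0 w).1 hz, (h0 w').1 (by omega)]
      · exact hlev (l w - 1) w w' (by omega) (by omega) (by tauto)
  have hstep : ∀ w q, G.Adj w q → l w = l q + 1 →
      (S w → f w = f q + 1) ∧ (¬ S w → f q = f w + 1) := by
    intro w q hwq hl
    by_cases hq : l q = 0
    · have hnS : ¬ S q := fun h => by
        have := hSl q h
        omega
      rw [hfN q hnS]
      refine ⟨fun h => ?_, fun h => ?_⟩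
      · rw [hfS w h]
        omega
      · rw [hfN w h]
        omega
    · have hS := hSstep w q hwq hl hq
      refine ⟨fun h => ?_, fun h => ?_⟩
      · rw [hfS w h, hfS q (hS.1 h)]
        omega
      · rw [hfN w h, hfN q fun h' => h (hS.2 h')]
        omega
  have hback : ∀ w w', f w' = f w + 1 → G.Adj w w' := by
    intro w w' hf
    by_cases hw' : S w'
    · obtain ⟨q, hq, hql⟩ := hpar w' (l w' - 1) (by have := hSl w' hw'; omega)
      have := (hstep w' q hq (by have := hSl w' hw'; omega)).1 hw'
      rw [hinj (by omega : f w = f q)]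
      exact hq.symm
    · have hw : ¬ S w := by
        intro h
        have := hSl w h
        rw [hfS w h, hfN w' hw'] at hf
        omega
      have hl : l w = l w' + 1 := by
        rw [hfN w hw, hfN w' hw'] at hf
        omega
      obtain ⟨q, hq, hql⟩ := hpar w (l w') hl
      have := (hstep w q hq (by omega)).2 hw
      rw [hinj (by omega : f w' = f q)]
      exact hq
  refine exists_iso_realLine hconn f hinj fun w w' => ⟨fun h => ?_, ?_⟩
  · rcases hadj w w' h with hl | hl
    · have := hstep w' w h.symm hl
      by_cases hS : S w'
      · exact Or.inl (this.1 hS)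
      · exact Or.inr (this.2 hS)
    · have := hstep w w' h hl
      by_cases hS : S w
      · exact Or.inr (this.1 hS)
      · exact Or.inl (this.2 hS)
  · rintro (h | h)
    · exact hback w w' h
    · exact (hback w' w h).symm

/-- A vertex of a line has at most two neighbours in the line. -/
theorem IsLine.not_three_neighbours {S : Set V} (h : IsLine G S) {x : V} (hx : x ∈ S)
    {y : Fin 3 → V} (hy : Function.Injective y) (hyS : ∀ i, y i ∈ S) (hadj : ∀ i, G.Adj x (y i)) :
    False := by
  obtain ⟨I, -, ⟨e⟩⟩ := h
  let m : Fin 3 → ℤ := fun i => (e ⟨y i, hyS i⟩).1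
  have hm : ∀ i, realLine.Adj (e ⟨x, hx⟩).1 (m i) := fun i =>
    (e.map_adj_iff (v := ⟨x, hx⟩) (w := ⟨y i, hyS i⟩)).2 (hadj i)
  have hinj : ∀ i j, i ≠ j → m i ≠ m j := fun i j hij h =>
    hij (hy (congrArg Subtype.val (e.injective (Subtype.ext h))))
  have h01 := hinj 0 1 (by decide)
  have h02 := hinj 0 2 (by decide)
  have h12 := hinj 1 2 (by decide)
  have a0 := realLine_adj.1 (hm 0)
  have a1 := realLine_adj.1 (hm 1)
  have a2 := realLine_adj.1 (hm 2)
  omega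

end Lines

/-! ### Branches that are lines -/

section Branch

variable {K : Type*} [Field K] [ValuativeRel K] [IsDiscreteValuationRing 𝒪[K]]

/-- If an order is not scalar modulo `p` at any vertex, then its branch is a line. -/
theorem isLine_branch {p : Kˣ} (hp : IsUnif p) {H : Subalgebra 𝒪[K] (Mat K)} (hH : IsOrder H)
    (hn : ∀ g, ¬ H ≤ congruenceOrder hp (conjOrder g)) :
    IsLine (bruhatTitsTree K) (branch H) := by
  obtain ⟨g₀, hg₀⟩ := exists_le_conjOrder hH
  have hex : ∀ w : branch H, ∃ n, RelPos p n (conjOrder g₀) w.1.1 := by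
    intro w
    obtain ⟨h, hh⟩ := isMaximalOrder_iff.1 w.1.2
    rw [hh]
    exact exists_relPos hp g₀ h
  choose l hl using hex
  have hl' : ∀ w n, RelPos p n (conjOrder g₀) w.1.1 → l w = n := fun w n h =>
    (hl w).unique hp h
  have hadj : ∀ w w' : branch H, ((bruhatTitsTree K).induce (branch H)).Adj w w' ↔
      RelPos p 1 w.1.1 w'.1.1 := fun w w' => neighbors_iff_relPos hp
  have hext : ∀ w w' : branch H, w.1.1 = w'.1.1 → w = w' := fun w w' h =>
    Subtype.ext (Subtype.ext h)
  refine exists_iso_realLine_of_level (V := branch H)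
    ⟨⟨conjOrder g₀, isMaximalOrder_iff.2 ⟨g₀, rfl⟩⟩, hg₀⟩ l ?_ ?_ ?_ ?_ ?_
  · intro w
    constructor
    · intro h
      have := hl w
      rw [h] at this
      exact hext _ _ (relPos_zero_iff.1 this).1
    · rintro rfl
      exact hl' _ _ (relPos_zero_iff.2 ⟨rfl, g₀, rfl⟩)
  · intro w w' h
    obtain ⟨g, e, ew⟩ := hl w
    have h1 := (hadj _ _).1 h
    rw [ew] at h1
    rcases relPos_succ_or hp h1 with h | ⟨m, hm, h⟩
    · exact Or.inl (hl' _ _ (e ▸ h))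
    · rw [hl' w' m ⟨g, e, h⟩]
      exact Or.inr hm
  · intro w n hw
    obtain ⟨g, e, ew⟩ := hl w
    rw [hw] at ew
    have hle : H ≤ conjOrder (g * diagGL (p ^ n)) :=
      le_trans (le_inf (e ▸ hg₀) (ew ▸ w.2)) (inf_le_conjOrder hp g n)
    let q : branch H := ⟨⟨conjOrder (g * diagGL (p ^ n)), isMaximalOrder_iff.2 ⟨_, rfl⟩⟩, hle⟩
    refine ⟨q, ?_, hl' q n ⟨g, e, rfl⟩⟩
    refine SimpleGraph.Adj.symm ((hadj q w).2 ?_)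
    rw [ew]
    exact relPos_one_conjOrder_succ p g n
  · intro w q q' hq hq' hlq hlq'
    obtain ⟨g, e, ew⟩ := hl w
    have key : ∀ q, ((bruhatTitsTree K).induce (branch H)).Adj w q → l w = l q + 1 →
        q.1.1 = conjOrder (g * diagGL (p ^ (l w - 1))) := by
      intro q hq hlq
      have h1 := (hadj _ _).1 hq
      rw [ew] at h1
      rcases relPos_succ_or hp h1 with h | ⟨m, hm, h⟩
      · have := hl' q _ (e ▸ h)
        omega
      · rw [h, hm, Nat.add_sub_cancel]
    exact hext _ _ ((key q hq hlq).trans (key q' hq' hlq').symm)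
  · intro w a b c ha hb hc
    by_contra! hne
    obtain ⟨g, hg⟩ := isMaximalOrder_iff.1 w.1.2
    have ha := (hadj _ _).1 ha
    have hb := (hadj _ _).1 hb
    have hc := (hadj _ _).1 hc
    have hw : H ≤ w.1.1 := w.2
    rw [hg] at ha hb hc hw
    exact hn g (le_congruenceOrder hp hw ha hb hc a.2 b.2 c.2 (fun h => hne.1 (hext _ _ h))
      (fun h => hne.2.1 (hext _ _ h)) fun h => hne.2.2 (hext _ _ h))

/-- If an order is scalar modulo `p` somewhere, then its branch is not a line. -/
theorem not_isLine_branch {p : Kˣ} (hp : IsUnif p) {H : Subalgebra 𝒪[K] (Mat K)}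
    {g : GL (Fin 2) K} (hg : H ≤ congruenceOrder hp (conjOrder g)) :
    ¬ IsLine (bruhatTitsTree K) (branch H) := by
  intro h
  obtain ⟨D, hD, hD'⟩ := exists_three_neighbours hp g
  have hmax : ∀ i, IsMaximalOrder (D i) := fun i => by
    obtain ⟨k, -, e⟩ := relPos_one_conjOrder_iff.1 (hD' i).1
    exact isMaximalOrder_iff.2 ⟨_, e⟩
  refine h.not_three_neighbours (x := ⟨conjOrder g, isMaximalOrder_iff.2 ⟨g, rfl⟩⟩)
    (y := fun i => ⟨D i, hmax i⟩) (hg.trans (congruenceOrder_le hp _))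
    (fun i j hij => hD (congrArg Subtype.val hij)) (fun i => hg.trans (hD' i).2) fun i => ?_
  exact (neighbors_iff_relPos hp).2 (hD' i).1

end Branch

/-! ### Bases of full orders -/

section Basis

variable {K : Type*} [Field K] [ValuativeRel K]

/-- The reduced discriminant `tr (i [j, k])` of the order with basis `1, i, j, k`, up to sign. -/
def redDisc {K : Type*} [Field K] (i j k : Mat K) : K :=
  Matrix.trace (i * (j * k - k * j))

/-- `R` is the free `𝒪`-module with basis `1, i, j, k`. -/
structure IsOrderBasis (R : Subalgebra 𝒪[K] (Mat K)) (i j k : Mat K) : Prop where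
  mem_i : i ∈ R
  mem_j : j ∈ R
  mem_k : k ∈ R
  exists_coeffs : ∀ x ∈ R, ∃ a ∈ 𝒪[K], ∃ b ∈ 𝒪[K], ∃ c ∈ 𝒪[K], ∃ d ∈ 𝒪[K],
    x = a • (1 : Mat K) + b • i + c • j + d • k
  redDisc_ne_zero : redDisc i j k ≠ 0

theorem redDisc_rotate {K : Type*} [Field K] (i j k : Mat K) : redDisc j k i = redDisc i j k := by
  simp only [redDisc, Matrix.trace_fin_two, Matrix.mul_apply, Fin.sum_univ_two, Matrix.sub_apply]
  ring

theorem IsOrderBasis.rotate {R : Subalgebra 𝒪[K] (Mat K)} {i j k : Mat K}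
    (h : IsOrderBasis R i j k) : IsOrderBasis R j k i := by
  refine ⟨h.mem_j, h.mem_k, h.mem_i, fun x hx => ?_, redDisc_rotate i j k ▸ h.redDisc_ne_zero⟩
  obtain ⟨a, ha, b, hb, c, hc, d, hd, rfl⟩ := h.exists_coeffs x hx
  exact ⟨a, ha, c, hc, d, hd, b, hb, by abel⟩

variable [IsDiscreteValuationRing 𝒪[K]]

theorem IsOrder.trace_mem {R : Subalgebra 𝒪[K] (Mat K)} (hR : IsOrder R) {x : Mat K}
    (hx : x ∈ R) : Matrix.trace x ∈ 𝒪[K] := by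
  obtain ⟨g, hg⟩ := exists_le_conjOrder hR
  have h := mem_conjOrder.1 (hg hx)
  have e : Matrix.trace x = Matrix.trace ((g⁻¹ : GL (Fin 2) K).1 * x * g.1) := by
    rw [Matrix.trace_mul_comm, Units.mul_inv_cancel_left]
  rw [e, Matrix.trace_fin_two]
  exact 𝒪[K].add_mem (h _ _) (h _ _)

theorem IsOrder.det_mem {R : Subalgebra 𝒪[K] (Mat K)} (hR : IsOrder R) {x : Mat K}
    (hx : x ∈ R) : Matrix.det x ∈ 𝒪[K] := by
  obtain ⟨g, hg⟩ := exists_le_conjOrder hR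
  have h := mem_conjOrder.1 (hg hx)
  have e : Matrix.det x = Matrix.det ((g⁻¹ : GL (Fin 2) K).1 * x * g.1) := by
    rw [Matrix.det_mul, mul_comm, ← Matrix.det_mul, Units.mul_inv_cancel_left]
  rw [e]
  exact det_mem_of_mem_intMat h

theorem IsOrder.scalar_mem {R : Subalgebra 𝒪[K] (Mat K)} (hR : IsOrder R) {s : K}
    (hs : s • (1 : Mat K) ∈ R) : s ∈ 𝒪[K] := by
  obtain ⟨g, hg⟩ := exists_le_conjOrder hR
  have h := mem_conjOrder.1 (hg hs)
  rw [mul_smul_comm, mul_one, smul_mul_assoc, Units.inv_mul] at h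
  simpa using h 0 0

/-- The number `1` extends to a basis of every full order: the image of the order in
`M₂(K) / K` is a lattice, with a basis that lifts. -/
theorem IsFullOrder.exists_isOrderBasis {R : Subalgebra 𝒪[K] (Mat K)} (hR : IsFullOrder R) :
    ∃ i j k, IsOrderBasis R i j k := by
  let φ : Mat K →ₗ[K] (Fin 3 → K) :=
    { toFun := fun x => ![x 0 1, x 1 0, x 0 0 - x 1 1]
      map_add' := fun x y => by
        ext l
        fin_cases l <;> simp
        ring
      map_smul' := fun c x => by
        ext l
        fin_cases l <;> simp
        ring }
  have hφ0 : ∀ x, φ x 0 = x 0 1 := fun _ => rfl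
  have hφ1 : ∀ x, φ x 1 = x 1 0 := fun _ => rfl
  have hφ2 : ∀ x, φ x 2 = x 0 0 - x 1 1 := fun _ => rfl
  have hφs : Function.Surjective φ := fun v => ⟨!![v 2, v 0; v 1, 0], by
    ext l
    fin_cases l <;> simp [φ]⟩
  let M : Submodule 𝒪[K] (Fin 3 → K) :=
    (Subalgebra.toSubmodule R).map (φ.restrictScalars 𝒪[K])
  have hspan : Submodule.span K (M : Set (Fin 3 → K)) = ⊤ := by
    have : (M : Set (Fin 3 → K)) = φ '' (R : Set (Mat K)) := rfl
    rw [this, Submodule.span_image, hR.2, Submodule.map_top, LinearMap.range_eq_top.2 hφs]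
  obtain ⟨b, hb⟩ := exists_basis_of_lattice M (Submodule.FG.map _ hR.1) hspan
  have hmem : ∀ l, b l ∈ M := fun l => (hb _).2 fun i => by
    rw [b.repr_self, Finsupp.single_apply]
    split_ifs
    · exact 𝒪[K].one_mem
    · exact 𝒪[K].zero_mem
  choose e heR he using hmem
  replace he : ∀ l, φ (e l) = b l := he
  replace heR : ∀ l, e l ∈ R := heR
  refine ⟨e 0, e 1, e 2, heR 0, heR 1, heR 2, fun x hx => ?_, ?_⟩
  · have hc : ∀ l, b.repr (φ x) l ∈ 𝒪[K] := (hb _).1 ⟨x, hx, rfl⟩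
    have hsum := b.sum_repr (φ x)
    rw [Fin.sum_univ_three, ← he 0, ← he 1, ← he 2, ← map_smul, ← map_smul, ← map_smul,
      ← map_add, ← map_add] at hsum
    generalize b.repr (φ x) = c at *
    have hyR : c 0 • e 0 + c 1 • e 1 + c 2 • e 2 ∈ R :=
      R.add_mem (R.add_mem (smul_mem_of_mem (hc 0) (heR 0)) (smul_mem_of_mem (hc 1) (heR 1)))
        (smul_mem_of_mem (hc 2) (heR 2))
    obtain ⟨s, hd⟩ : ∃ s : K, x = s • (1 : Mat K) + (c 0 • e 0 + c 1 • e 1 + c 2 • e 2) := by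
      generalize c 0 • e 0 + c 1 • e 1 + c 2 • e 2 = y at *
      have h0 := congrFun hsum 0
      have h1 := congrFun hsum 1
      have h2 := congrFun hsum 2
      rw [hφ0, hφ0] at h0
      rw [hφ1, hφ1] at h1
      rw [hφ2, hφ2] at h2
      refine ⟨x 0 0 - y 0 0, ?_⟩
      ext i j
      fin_cases i <;> fin_cases j
      · simp
      · simp [h0]
      · simp [h1]
      · simp
        linear_combination h2
    refine ⟨s, hR.1.scalar_mem ?_, c 0, hc 0, c 1, hc 1, c 2, hc 2,
      hd.trans (by simp only [add_assoc])⟩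
    rw [eq_sub_iff_add_eq.2 hd.symm]
    exact R.sub_mem hx hyR
  · have hdet := ((Pi.basisFun K (Fin 3)).isUnit_det b).ne_zero
    rw [Module.Basis.det_apply] at hdet
    have hm : (Pi.basisFun K (Fin 3)).toMatrix b = Matrix.of fun r c => φ (e c) r := by
      ext r c
      simp [Module.Basis.toMatrix_apply, he]
    rw [hm, Matrix.det_fin_three] at hdet
    simp only [Matrix.of_apply, hφ0, hφ1, hφ2] at hdet
    intro h0
    apply hdet
    simp only [redDisc, Matrix.trace_fin_two, Matrix.mul_apply, Fin.sum_univ_two,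
      Matrix.sub_apply] at h0
    linear_combination h0

end Basis

/-! ### A principal codifferent -/

section Principal

variable {K : Type*} [Field K] [ValuativeRel K]

theorem codiff_mul_left {R : Subalgebra 𝒪[K] (Mat K)} {r a : Mat K} (hr : r ∈ R)
    (ha : a ∈ codiff R) : r * a ∈ codiff R := by
  intro s hs
  rw [mul_assoc, Matrix.trace_mul_comm, mul_assoc]
  exact ha _ (R.mul_mem hs hr)

theorem codiff_mul_right {R : Subalgebra 𝒪[K] (Mat K)} {r a : Mat K} (hr : r ∈ R)
    (ha : a ∈ codiff R) : a * r ∈ codiff R := by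
  intro s hs
  rw [mul_assoc]
  exact ha _ (R.mul_mem hr hs)

/-- An order is Gorenstein if its codifferent is generated by a single invertible element, both as a
left and as a right module. -/
theorem isGorenstein_of_principal {R : Subalgebra 𝒪[K] (Mat K)} (hR : IsFullOrder R)
    (x : GL (Fin 2) K) (hx : x.1 ∈ codiff R) (hl : ∀ a ∈ codiff R, ∃ r ∈ R, a = x.1 * r)
    (hr : ∀ a ∈ codiff R, ∃ r ∈ R, a = r * x.1) : IsGorenstein R := by
  have hfg : ∀ z : Mat K,
      ((Subalgebra.toSubmodule R).map (LinearMap.mulLeft 𝒪[K] z)).FG :=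
    fun z => Submodule.FG.map _ hR.1
  have hspan : ∀ z : GL (Fin 2) K, Submodule.span K
      (((Subalgebra.toSubmodule R).map (LinearMap.mulLeft 𝒪[K] z.1) :
        Submodule 𝒪[K] (Mat K)) : Set (Mat K)) = ⊤ := by
    intro z
    have : (((Subalgebra.toSubmodule R).map (LinearMap.mulLeft 𝒪[K] z.1) :
        Submodule 𝒪[K] (Mat K)) : Set (Mat K)) = LinearMap.mulLeft K z.1 '' (R : Set (Mat K)) := rfl
    rw [this, Submodule.span_image, hR.2, Submodule.map_top, LinearMap.range_eq_top]
    exact fun y => ⟨(z⁻¹ : GL (Fin 2) K).1 * y, Units.mul_inv_cancel_left z y⟩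
  have hC : codiff R = (Subalgebra.toSubmodule R).map (LinearMap.mulLeft 𝒪[K] x.1) := by
    ext a
    constructor
    · intro ha
      obtain ⟨r, hr, rfl⟩ := hl a ha
      exact ⟨r, hr, rfl⟩
    · rintro ⟨r, hr, rfl⟩
      exact codiff_mul_right hr hx
  have hJr : ∀ r ∈ R, ∃ s ∈ R, (x⁻¹ : GL (Fin 2) K).1 * r = s * (x⁻¹ : GL (Fin 2) K).1 := by
    intro r hr'
    obtain ⟨s, hs, e⟩ := hl _ (codiff_mul_left hr' hx)
    refine ⟨s, hs, ?_⟩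
    rw [Units.eq_mul_inv_iff_mul_eq, mul_assoc, e, Units.inv_mul_cancel_left]
  have hJl : ∀ r ∈ R, ∃ s ∈ R, r * (x⁻¹ : GL (Fin 2) K).1 = (x⁻¹ : GL (Fin 2) K).1 * s := by
    intro r hr'
    obtain ⟨s, hs, e⟩ := hr _ (codiff_mul_right hr' hx)
    refine ⟨s, hs, ?_⟩
    rw [Units.eq_inv_mul_iff_mul_eq, ← mul_assoc, e, Units.mul_inv_cancel_right]
  refine ⟨hR, ⟨hC ▸ hfg _, hC ▸ hspan x, fun r hr a ha => codiff_mul_left hr ha,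
    fun a ha r hr => codiff_mul_right hr ha⟩,
    (Subalgebra.toSubmodule R).map (LinearMap.mulLeft 𝒪[K] (x⁻¹ : GL (Fin 2) K).1),
    ⟨hfg _, hspan x⁻¹, ?_, ?_⟩, ?_, ?_⟩
  · rintro r hr _ ⟨s, hs, rfl⟩
    obtain ⟨t, ht, e⟩ := hJl r hr
    refine ⟨t * s, R.mul_mem ht hs, ?_⟩
    rw [LinearMap.mulLeft_apply, LinearMap.mulLeft_apply, ← mul_assoc, ← mul_assoc, e]
  · rintro _ ⟨s, hs, rfl⟩ r hr
    exact ⟨s * r, R.mul_mem hs hr, (mul_assoc _ _ _).symm⟩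
  · refine le_antisymm (Submodule.mul_le.2 ?_) fun r hr => ?_
    · rintro a ha _ ⟨s, hs, rfl⟩
      obtain ⟨r, hr, rfl⟩ := hr a ha
      rw [LinearMap.mulLeft_apply, mul_assoc, Units.mul_inv_cancel_left]
      exact R.mul_mem hr hs
    · rw [← Units.mul_inv_cancel_left x r]
      exact Submodule.mul_mem_mul hx ⟨r, hr, rfl⟩
  · refine le_antisymm (Submodule.mul_le.2 ?_) fun r hr => ?_
    · rintro _ ⟨s, hs, rfl⟩ a ha
      obtain ⟨t, ht, e⟩ := hJr s hs
      obtain ⟨r, hr, rfl⟩ := hl a ha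
      rw [LinearMap.mulLeft_apply, e, mul_assoc, Units.inv_mul_cancel_left]
      exact R.mul_mem ht hr
    · obtain ⟨s, hs, e⟩ := hJl r hr
      have : r = ((x⁻¹ : GL (Fin 2) K).1 * s) * x.1 := by
        rw [← e, Units.inv_mul_cancel_right]
      rw [this]
      exact Submodule.mul_mem_mul ⟨s, hs, rfl⟩ hx

theorem mem_integer_of_vecMul {n : ℕ} {A : Matrix (Fin n) (Fin n) K} (hA : ∀ a b, A a b ∈ 𝒪[K])
    (hdet : A.det ≠ 0) (hdet' : (A.det)⁻¹ ∈ 𝒪[K]) {c : Fin n → K}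
    (hc : ∀ b, Matrix.vecMul c A b ∈ 𝒪[K]) (a : Fin n) : c a ∈ 𝒪[K] := by
  let B : Matrix (Fin n) (Fin n) 𝒪[K] := Matrix.of fun a b => ⟨A a b, hA a b⟩
  have hB : A = B.map (algebraMap 𝒪[K] K) := rfl
  have hadj : A.adjugate = B.adjugate.map (algebraMap 𝒪[K] K) := by
    rw [hB]
    exact ((algebraMap 𝒪[K] K).map_adjugate B).symm
  have e : c = (A.det)⁻¹ • Matrix.vecMul (Matrix.vecMul c A) A.adjugate := by
    rw [Matrix.vecMul_vecMul, Matrix.mul_adjugate, Matrix.vecMul_smul, Matrix.vecMul_one,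
      inv_smul_smul₀ hdet]
  have e' : Matrix.vecMul (Matrix.vecMul c A) A.adjugate a =
      ∑ l, Matrix.vecMul c A l * A.adjugate l a := rfl
  rw [e, Pi.smul_apply, smul_eq_mul, e']
  refine 𝒪[K].mul_mem hdet' (sum_mem fun l _ => 𝒪[K].mul_mem (hc l) ?_)
  rw [hadj]
  exact (B.adjugate l a).2

/-- The coordinates of a matrix in the standard basis, row by row. -/
def coords {K : Type*} [Field K] (x : Mat K) : Fin 4 → K := ![x 0 0, x 0 1, x 1 0, x 1 1]

/-- The matrix of the coordinates of `1, i, j, k`. -/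
def coordMatrix {K : Type*} [Field K] (i j k : Mat K) : Matrix (Fin 4) (Fin 4) K :=
  Matrix.of ![coords 1, coords i, coords j, coords k]

/-- The Gram matrix of the bilinear form `(y, z) ↦ tr (x y z)` in the standard basis. -/
def traceGram {K : Type*} [Field K] (x : Mat K) : Matrix (Fin 4) (Fin 4) K :=
  !![x 0 0, x 1 0, 0, 0; 0, 0, x 0 0, x 1 0; x 0 1, x 1 1, 0, 0; 0, 0, x 0 1, x 1 1]

theorem det_traceGram {K : Type*} [Field K] (x : Mat K) :
    (traceGram x).det = -(x.det) ^ 2 := by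
  rw [Matrix.det_fin_two]
  simp [traceGram, Matrix.det_succ_row_zero, Fin.sum_univ_succ, Fin.succAbove]
  ring

theorem det_coordMatrix {K : Type*} [Field K] (i j k : Mat K) :
    (coordMatrix i j k).det = -redDisc i j k := by
  simp [coordMatrix, coords, redDisc, Matrix.trace_fin_two, Matrix.mul_apply,
    Matrix.det_succ_row_zero, Fin.sum_univ_succ, Fin.succAbove]
  ring

theorem coords_vecMul_traceGram {K : Type*} [Field K] (x y z : Mat K) :
    Matrix.vecMul (coords y) (traceGram x) ⬝ᵥ coords z = Matrix.trace (x * y * z) := by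
  simp [coords, traceGram, Matrix.trace_fin_two, Matrix.mul_apply, Matrix.vecMul, dotProduct,
    Fin.sum_univ_succ]
  ring

variable {R : Subalgebra 𝒪[K] (Mat K)} {i j k : Mat K}

/-- If the form `tr (x y z)` takes integral values on `R × R`, and its discriminant is a unit, then
it is a perfect pairing on `R`. -/
theorem IsOrderBasis.mem_of_trace_mem (h : IsOrderBasis R i j k) {x : Mat K}
    (hx : x ∈ codiff R) (h0 : redDisc i j k * x.det ≠ 0)
    (hu : (redDisc i j k * x.det)⁻¹ ∈ 𝒪[K]) {y : Mat K}
    (hy : ∀ z ∈ R, Matrix.trace (x * y * z) ∈ 𝒪[K]) : y ∈ R := by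
  let E := coordMatrix i j k
  have hrow : ∀ a, ∃ e ∈ R, E a = coords e := by
    intro a
    fin_cases a
    exacts [⟨1, one_mem R, rfl⟩, ⟨i, h.mem_i, rfl⟩, ⟨j, h.mem_j, rfl⟩, ⟨k, h.mem_k, rfl⟩]
  choose e heR he using hrow
  have hE : IsUnit E.det := by
    rw [det_coordMatrix, isUnit_iff_ne_zero, neg_ne_zero]
    exact h.redDisc_ne_zero
  let A := E * traceGram x * E.transpose
  have hAapp : ∀ (v : Fin 4 → K) b, Matrix.vecMul v (traceGram x * E.transpose) b =
      Matrix.vecMul v (traceGram x) ⬝ᵥ coords (e b) := by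
    intro v b
    rw [← Matrix.vecMul_vecMul, ← he]
    rfl
  have hA : ∀ a b, A a b ∈ 𝒪[K] := by
    intro a b
    have : A a b = Matrix.vecMul (E a) (traceGram x * E.transpose) b := by
      simp only [A, mul_assoc]
      rfl
    rw [this, hAapp, he, coords_vecMul_traceGram, mul_assoc]
    exact hx _ (R.mul_mem (heR a) (heR b))
  have hdet : A.det = -(redDisc i j k * x.det) ^ 2 := by
    simp only [A, Matrix.det_mul, Matrix.det_transpose, E, det_coordMatrix, det_traceGram]
    ring
  let c := Matrix.vecMul (coords y) E⁻¹
  have hcE : Matrix.vecMul c E = coords y := by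
    rw [Matrix.vecMul_vecMul, Matrix.nonsing_inv_mul _ hE, Matrix.vecMul_one]
  have hc : ∀ a, c a ∈ 𝒪[K] := by
    refine mem_integer_of_vecMul hA ?_ ?_ fun b => ?_
    · rw [hdet, neg_ne_zero]
      exact pow_ne_zero 2 h0
    · rw [hdet, inv_neg, ← inv_pow]
      exact 𝒪[K].neg_mem (𝒪[K].pow_mem hu 2)
    · rw [show A = E * (traceGram x * E.transpose) from mul_assoc _ _ _, ← Matrix.vecMul_vecMul, hcE,
        hAapp, coords_vecMul_traceGram]
      exact hy _ (heR b)
  have e4 : y = c 0 • (1 : Mat K) + c 1 • i + c 2 • j + c 3 • k := by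
    have hs : ∀ l, coords y l = c 0 * coords 1 l + c 1 * coords i l + c 2 * coords j l +
        c 3 * coords k l := by
      intro l
      rw [← hcE, Matrix.vecMul, dotProduct, Fin.sum_univ_four]
      rfl
    ext a b
    simp only [Matrix.add_apply, Matrix.smul_apply, smul_eq_mul]
    fin_cases a <;> fin_cases b
    exacts [hs 0, hs 1, hs 2, hs 3]
  rw [e4]
  exact R.add_mem (R.add_mem (R.add_mem (smul_mem_of_mem (hc 0) (one_mem R))
    (smul_mem_of_mem (hc 1) h.mem_i)) (smul_mem_of_mem (hc 2) h.mem_j))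
    (smul_mem_of_mem (hc 3) h.mem_k)

theorem mul_self_of_trace_eq_zero {K : Type*} [Field K] {x : Mat K} (hx : Matrix.trace x = 0) :
    x * x = -x.det • (1 : Mat K) := by
  rw [Matrix.trace_fin_two] at hx
  rw [Matrix.det_fin_two]
  ext a b
  fin_cases a <;> fin_cases b <;> simp [Matrix.mul_apply]
  · linear_combination x 0 0 * hx
  · linear_combination x 0 1 * hx
  · linear_combination x 1 0 * hx
  · linear_combination x 1 1 * hx

/-- The order is Gorenstein if its codifferent contains a traceless element of the largest possible
determinant. -/
theorem IsOrderBasis.isGorenstein (h : IsOrderBasis R i j k) (hR : IsFullOrder R) {x : Mat K}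
    (hx : x ∈ codiff R) (htr : Matrix.trace x = 0) (h0 : redDisc i j k * x.det ≠ 0)
    (hu : (redDisc i j k * x.det)⁻¹ ∈ 𝒪[K]) : IsGorenstein R := by
  have hd := right_ne_zero_of_mul h0
  obtain ⟨g, rfl⟩ : IsUnit x := (Matrix.isUnit_iff_isUnit_det _).2 (isUnit_iff_ne_zero.2 hd)
  have hl : ∀ a ∈ codiff R, ∃ r ∈ R, a = g.1 * r := by
    intro a ha
    refine ⟨(g⁻¹ : GL (Fin 2) K).1 * a, h.mem_of_trace_mem hx h0 hu fun z hz => ?_,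
      (Units.mul_inv_cancel_left g a).symm⟩
    rw [Units.mul_inv_cancel_left]
    exact ha z hz
  refine isGorenstein_of_principal hR g hx hl fun a ha => ?_
  -- conjugation by `x` preserves `R`, and it is an involution as `x²` is a scalar
  obtain ⟨r, hr, rfl⟩ := hl a ha
  obtain ⟨s, hs, e⟩ := hl _ (codiff_mul_left hr hx)
  refine ⟨s, hs, ?_⟩
  have hsq := mul_self_of_trace_eq_zero htr
  have e1 : g.1 * (g.1 * r) = g.1 * (s * g.1) := by
    calc g.1 * (g.1 * r) = g.1 * g.1 * r := (mul_assoc _ _ _).symm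
      _ = r * (g.1 * g.1) := by rw [hsq, smul_mul_assoc, one_mul, mul_smul_comm, mul_one]
      _ = g.1 * (s * g.1) := by rw [← mul_assoc, e, mul_assoc]
  exact g.isUnit.mul_left_cancel e1

end Principal

/-! ### The dual basis and the multiplication table of a full order -/

section Table

variable {K : Type*} [Field K]

/-- The multiplication table of the products `β γ`, `γ α`, `α β` of three traceless matrices, up to
cyclic permutation. It follows from `α² = -det α` and `α β + β α = tr (α β)`. -/
theorem traceless_table {α β γ : Mat K} (hα : Matrix.trace α = 0) (hβ : Matrix.trace β = 0)
    (hγ : Matrix.trace γ = 0) :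
    (β * γ) * (β * γ) = Matrix.trace (β * γ) • (β * γ) - (β.det * γ.det) • (1 : Mat K) ∧
    (γ * α) * (α * β) = α.det • (β * γ) - (α.det * Matrix.trace (β * γ)) • (1 : Mat K) ∧
    (α * β) * (γ * α) = Matrix.trace (α * β) • (γ * α) + Matrix.trace (γ * α) • (α * β) -
      α.det • (β * γ) - (Matrix.trace (γ * α) * Matrix.trace (α * β)) • (1 : Mat K) := by
  rw [Matrix.trace_fin_two] at hα hβ hγ
  have e : ∀ x : Mat K, x 0 0 + x 1 1 = 0 → x = !![x 0 0, x 0 1; x 1 0, -x 0 0] := by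
    intro x hx
    rw [← eq_neg_of_add_eq_zero_right hx]
    exact Matrix.eta_fin_two x
  rw [e α hα, e β hβ, e γ hγ]
  refine ⟨?_, ?_, ?_⟩ <;>
  · ext a b
    fin_cases a <;> fin_cases b <;> simp [Matrix.trace_fin_two, Matrix.det_fin_two] <;> ring

/-- The element of the dual basis of `1, i, j, k` that corresponds to `i`. -/
def dualElt (i j k : Mat K) : Mat K := (redDisc i j k)⁻¹ • (j * k - k * j)

theorem trace_dualElt (i j k : Mat K) : Matrix.trace (dualElt i j k) = 0 := by
  rw [dualElt, Matrix.trace_smul, Matrix.trace_sub, Matrix.trace_mul_comm, sub_self, smul_zero]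

theorem redDisc_mul_det_dualElt (i j k : Mat K) :
    redDisc i j k * (dualElt i j k).det = -Matrix.trace (dualElt i j k * (j * k)) := by
  by_cases h : redDisc i j k = 0
  · simp [dualElt, h]
  have e : (j * k - k * j).det = -Matrix.trace ((j * k - k * j) * (j * k)) := by
    rw [Matrix.det_fin_two, Matrix.trace_fin_two]
    simp only [Matrix.mul_apply, Fin.sum_univ_two, Matrix.sub_apply]
    ring
  rw [dualElt, smul_mul_assoc, Matrix.trace_smul, Matrix.det_smul, e, Fintype.card_fin]
  rw [smul_eq_mul]
  field_simp

theorem redDisc_mul_trace_dualElt (i j k : Mat K) :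
    redDisc i j k * Matrix.trace (dualElt j k i * dualElt k i j) =
      Matrix.trace (dualElt j k i * (i * j - j * i)) := by
  by_cases h : redDisc i j k = 0
  · simp [dualElt, redDisc_rotate j k i, redDisc_rotate i j k, h]
  have e : dualElt k i j = (redDisc i j k)⁻¹ • (i * j - j * i) := by
    rw [dualElt, redDisc_rotate j k i, redDisc_rotate i j k]
  rw [e, mul_smul_comm, Matrix.trace_smul, smul_eq_mul, mul_inv_cancel_left₀ h]

/-- Up to sign and up to a scalar, a product of two elements of the dual basis gives back the third
element of the basis. -/
theorem exists_redDisc_smul_dualElt_mul (i j k : Mat K) (h : redDisc i j k ≠ 0) :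
    ∃ s : K, redDisc i j k • (dualElt j k i * dualElt k i j) = s • (1 : Mat K) - i := by
  have e1 : dualElt k i j = (redDisc i j k)⁻¹ • (i * j - j * i) := by
    rw [dualElt, redDisc_rotate j k i, redDisc_rotate i j k]
  have e2 : dualElt j k i = (redDisc i j k)⁻¹ • (k * i - i * k) := by
    rw [dualElt, redDisc_rotate i j k]
  have key : ∃ t : K, (k * i - i * k) * (i * j - j * i) = t • (1 : Mat K) - redDisc i j k • i := by
    refine ⟨((k * i - i * k) * (i * j - j * i)) 0 0 + redDisc i j k * i 0 0, ?_⟩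
    rw [redDisc, Matrix.trace_fin_two]
    ext a b
    fin_cases a <;> fin_cases b <;>
      simp [Matrix.mul_apply, Fin.sum_univ_two, Matrix.sub_apply] <;> ring
  obtain ⟨t, ht⟩ := key
  refine ⟨(redDisc i j k)⁻¹ * t, ?_⟩
  rw [e1, e2, smul_mul_assoc, mul_smul_comm, ht, smul_inv_smul₀ h, smul_sub, smul_smul,
    inv_smul_smul₀ h]

end Table

section Dual

variable {K : Type*} [Field K] [ValuativeRel K] {R : Subalgebra 𝒪[K] (Mat K)} {i j k : Mat K}

theorem IsOrderBasis.dualElt_mem (h : IsOrderBasis R i j k) : dualElt i j k ∈ codiff R := by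
  intro x hx
  obtain ⟨a, ha, b, hb, c, hc, d, hd, rfl⟩ := h.exists_coeffs x hx
  have hN := h.redDisc_ne_zero
  have e : Matrix.trace ((j * k - k * j) * (a • (1 : Mat K) + b • i + c • j + d • k)) =
      b * redDisc i j k := by
    simp only [redDisc, Matrix.trace_fin_two, Matrix.mul_apply, Fin.sum_univ_two, Matrix.sub_apply,
      Matrix.add_apply, Matrix.smul_apply, Matrix.one_apply, smul_eq_mul]
    simp
    ring
  rw [dualElt, smul_mul_assoc, Matrix.trace_smul, e, smul_eq_mul, mul_comm, mul_assoc,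
    mul_inv_cancel₀ hN, mul_one]
  exact hb

theorem IsOrderBasis.disc_det_mem (h : IsOrderBasis R i j k) :
    redDisc i j k * (dualElt i j k).det ∈ 𝒪[K] := by
  rw [redDisc_mul_det_dualElt]
  exact 𝒪[K].neg_mem (h.dualElt_mem _ (R.mul_mem h.mem_j h.mem_k))

theorem IsOrderBasis.disc_trace_mem (h : IsOrderBasis R i j k) :
    redDisc i j k * Matrix.trace (dualElt j k i * dualElt k i j) ∈ 𝒪[K] := by
  rw [redDisc_mul_trace_dualElt]
  exact h.rotate.dualElt_mem _ (R.sub_mem (R.mul_mem h.mem_i h.mem_j) (R.mul_mem h.mem_j h.mem_i))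

/-- Four matrices `1, I, J, L` whose products are integral combinations of themselves generate an
order. -/
theorem exists_order_of_table {I J L : Mat K}
    (h : ∀ x ∈ ({I, J, L} : Set (Mat K)), ∀ y ∈ ({I, J, L} : Set (Mat K)),
      x * y ∈ Submodule.span 𝒪[K] {1, I, J, L}) :
    ∃ G : Subalgebra 𝒪[K] (Mat K), IsOrder G ∧ I ∈ G ∧ J ∈ G ∧ L ∈ G := by
  let S := Submodule.span 𝒪[K] ({1, I, J, L} : Set (Mat K))
  have hS : ∀ x ∈ ({1, I, J, L} : Set (Mat K)), x ∈ S := fun x hx => Submodule.subset_span hx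
  have hmul : S * S ≤ S := by
    rw [Submodule.span_mul_span, Submodule.span_le]
    rintro _ ⟨x, hx, y, hy, rfl⟩
    change x * y ∈ S
    rcases hx with rfl | hx
    · rw [one_mul]
      exact hS y hy
    rcases hy with rfl | hy
    · rw [mul_one]
      exact hS x (Or.inr hx)
    exact h x hx y hy
  let G : Subalgebra 𝒪[K] (Mat K) := S.toSubalgebra (hS 1 (by simp))
    fun x y hx hy => hmul (Submodule.mul_mem_mul hx hy)
  refine ⟨G, ?_, hS I (by simp), hS J (by simp), hS L (by simp)⟩
  have : Subalgebra.toSubmodule G = S := Submodule.toSubalgebra_toSubmodule _ _ _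
  rw [IsOrder, this]
  exact Submodule.fg_span (Set.toFinite _)

variable [IsDiscreteValuationRing 𝒪[K]]

theorem mem_integer_of_quadratic {s b c : K} (hb : b ∈ 𝒪[K]) (hc : c ∈ 𝒪[K])
    (h : s ^ 2 + b * s + c = 0) : s ∈ 𝒪[K] := by
  by_contra hs
  have hi := inv_mem_integer_of_notMem hs
  have h0 : s ≠ 0 := by
    rintro rfl
    exact hs 𝒪[K].zero_mem
  have e : s = -b - c * s⁻¹ := by
    field_simp
    linear_combination h
  exact hs (e ▸ 𝒪[K].sub_mem (𝒪[K].neg_mem hb) (𝒪[K].mul_mem hc hi))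

/-- If the ternary quadratic form `N det` on the traceless part of the codifferent, in which `N` is
the reduced discriminant, is divisible by `p`, then the order is `𝒪 + p G` for an order `G`. -/
theorem IsOrderBasis.exists_le_congruenceOrder (h : IsOrderBasis R i j k) (hR : IsOrder R)
    {p : Kˣ} (hp : IsUnif p) {α β γ : Mat K} (eα : α = dualElt i j k) (eβ : β = dualElt j k i)
    (eγ : γ = dualElt k i j) {N : K} (eN : N = redDisc i j k)
    (ha : (p : K)⁻¹ * (N * α.det) ∈ 𝒪[K]) (hb : (p : K)⁻¹ * (N * β.det) ∈ 𝒪[K])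
    (hc : (p : K)⁻¹ * (N * γ.det) ∈ 𝒪[K]) (hu : (p : K)⁻¹ * (N * Matrix.trace (β * γ)) ∈ 𝒪[K])
    (hv : (p : K)⁻¹ * (N * Matrix.trace (γ * α)) ∈ 𝒪[K])
    (hw : (p : K)⁻¹ * (N * Matrix.trace (α * β)) ∈ 𝒪[K]) :
    ∃ g, R ≤ congruenceOrder hp (conjOrder g) := by
  have hp0 := p.ne_zero
  let I := ((p : K)⁻¹ * N) • (β * γ)
  let J := ((p : K)⁻¹ * N) • (γ * α)
  let L := ((p : K)⁻¹ * N) • (α * β)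
  have tα : Matrix.trace α = 0 := eα ▸ trace_dualElt _ _ _
  have tβ : Matrix.trace β = 0 := eβ ▸ trace_dualElt _ _ _
  have tγ : Matrix.trace γ = 0 := eγ ▸ trace_dualElt _ _ _
  obtain ⟨a1, a2, a3⟩ := traceless_table tα tβ tγ
  obtain ⟨b1, b2, b3⟩ := traceless_table tβ tγ tα
  obtain ⟨c1, c2, c3⟩ := traceless_table tγ tα tβ
  have hS : ∀ a ∈ 𝒪[K], ∀ b ∈ 𝒪[K], ∀ c ∈ 𝒪[K], ∀ d ∈ 𝒪[K], ∀ x : Mat K,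
      x = a • (1 : Mat K) + b • I + c • J + d • L → x ∈ Submodule.span 𝒪[K] {1, I, J, L} := by
    rintro a ha b hb c hc d hd _ rfl
    have hsm : ∀ a ∈ 𝒪[K], ∀ x ∈ ({1, I, J, L} : Set (Mat K)),
        a • x ∈ Submodule.span 𝒪[K] ({1, I, J, L} : Set (Mat K)) := fun a ha x hx =>
      Submodule.smul_mem _ (⟨a, ha⟩ : 𝒪[K]) (Submodule.subset_span hx)
    exact add_mem (add_mem (add_mem (hsm a ha _ (by simp)) (hsm b hb _ (by simp)))
      (hsm c hc _ (by simp))) (hsm d hd _ (by simp))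
  have z := 𝒪[K].zero_mem
  have M := fun {a b : K} (ha : a ∈ 𝒪[K]) (hb : b ∈ 𝒪[K]) => 𝒪[K].mul_mem ha hb
  have Ng := fun {a : K} (ha : a ∈ 𝒪[K]) => 𝒪[K].neg_mem ha
  have pull : ∀ x y : Mat K, (((p : K)⁻¹ * N) • x) * (((p : K)⁻¹ * N) • y) =
      (((p : K)⁻¹ * N) * ((p : K)⁻¹ * N)) • (x * y) := fun x y => by
    rw [smul_mul_assoc, mul_smul_comm, smul_smul]
  obtain ⟨G, hG, hI, hJ, hL⟩ := exists_order_of_table (I := I) (J := J) (L := L) (by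
    rintro x (rfl | rfl | rfl) y (rfl | rfl | rfl)
    · refine hS _ (Ng (M hb hc)) _ hu 0 z 0 z _ ?_
      rw [pull, a1]
      module
    · refine hS _ (Ng (M hc hw)) 0 z 0 z _ hc _ ?_
      rw [pull, c2]
      module
    · refine hS _ (Ng (M hw hu)) _ hw _ (Ng hb) _ hu _ ?_
      rw [pull, b3]
      module
    · refine hS _ (Ng (M hu hv)) _ hv _ hu _ (Ng hc) _ ?_
      rw [pull, c3]
      module
    · refine hS _ (Ng (M hc ha)) 0 z _ hv 0 z _ ?_
      rw [pull, b1]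
      module
    · refine hS _ (Ng (M ha hu)) _ ha 0 z 0 z _ ?_
      rw [pull, a2]
      module
    · refine hS _ (Ng (M hb hv)) 0 z _ hb 0 z _ ?_
      rw [pull, b2]
      module
    · refine hS _ (Ng (M hv hw)) _ (Ng ha) _ hw _ hv _ ?_
      rw [pull, a3]
      module
    · refine hS _ (Ng (M ha hb)) 0 z 0 z _ hw _ ?_
      rw [pull, c1]
      module)
  obtain ⟨g, hg⟩ := exists_le_conjOrder hG
  refine ⟨g, le_trans (fun x hx => ?_) (congruenceOrder_mono hp hg)⟩
  -- each basis element differs by an integral scalar from an element of `p G`; the scalar is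
  -- integral because it satisfies a monic quadratic equation
  have key : ∀ {x : Mat K}, x ∈ R → ∀ y : Mat K, ((p : K)⁻¹ * N) • y ∈ G →
      (∃ s : K, N • y = s • (1 : Mat K) - x) → x ∈ congruenceOrder hp G := by
    rintro x hx y hy ⟨s, hs⟩
    have hyG : N • y ∈ G := by
      have := smul_mem_of_mem hp.mem hy
      rwa [smul_smul, mul_inv_cancel_left₀ hp0] at this
    have hs' : s ∈ 𝒪[K] := by
      have hdet : s ^ 2 + -Matrix.trace x * s + (x.det - (N • y).det) = 0 := by
        rw [hs, Matrix.det_fin_two, Matrix.det_fin_two, Matrix.trace_fin_two]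
        simp
        ring
      exact mem_integer_of_quadratic (𝒪[K].neg_mem (hR.trace_mem hx))
        (𝒪[K].sub_mem (hR.det_mem hx) (hG.det_mem hyG)) hdet
    refine ⟨s, hs', -(((p : K)⁻¹ * N) • y), G.neg_mem hy, ?_⟩
    rw [smul_neg, smul_smul, mul_inv_cancel_left₀ hp0, hs]
    abel
  have hi := key h.mem_i (β * γ) hI (by
    rw [eβ, eγ, eN]
    exact exists_redDisc_smul_dualElt_mul i j k h.redDisc_ne_zero)
  have hj := key h.mem_j (γ * α) hJ (by
    rw [eγ, eα, eN, ← redDisc_rotate]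
    exact exists_redDisc_smul_dualElt_mul j k i h.rotate.redDisc_ne_zero)
  have hk := key h.mem_k (α * β) hL (by
    rw [eα, eβ, eN, ← redDisc_rotate, ← redDisc_rotate]
    exact exists_redDisc_smul_dualElt_mul k i j h.rotate.rotate.redDisc_ne_zero)
  obtain ⟨a, ha, b, hb, c, hc, d, hd, rfl⟩ := h.exists_coeffs x hx
  exact add_mem (add_mem (add_mem (smul_mem_of_mem ha (one_mem _)) (smul_mem_of_mem hb hi))
    (smul_mem_of_mem hc hj)) (smul_mem_of_mem hd hk)

/-- A full order that is not Gorenstein is scalar modulo `p` in some maximal order: its ternary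
quadratic form takes no unit values at the vectors of the dual basis and at their sums, so that all
its coefficients are divisible by `p`. -/
theorem exists_le_congruenceOrder_of_not_isGorenstein (hR : IsFullOrder R) (hG : ¬ IsGorenstein R)
    {p : Kˣ} (hp : IsUnif p) : ∃ g, R ≤ congruenceOrder hp (conjOrder g) := by
  obtain ⟨i, j, k, h⟩ := hR.exists_isOrderBasis
  have ha := h.disc_det_mem
  have hb := h.rotate.disc_det_mem
  have hc := h.rotate.rotate.disc_det_mem
  have hu := h.disc_trace_mem
  have hv := h.rotate.disc_trace_mem
  have hw := h.rotate.rotate.disc_trace_mem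
  have mα := h.dualElt_mem
  have mβ := h.rotate.dualElt_mem
  have mγ := h.rotate.rotate.dualElt_mem
  have tα := trace_dualElt i j k
  have tβ := trace_dualElt j k i
  have tγ := trace_dualElt k i j
  rw [redDisc_rotate j k i] at hc hw
  rw [redDisc_rotate i j k] at hb hc hv hw
  obtain ⟨α, eα⟩ : ∃ α, α = dualElt i j k := ⟨_, rfl⟩
  obtain ⟨β, eβ⟩ : ∃ β, β = dualElt j k i := ⟨_, rfl⟩
  obtain ⟨γ, eγ⟩ : ∃ γ, γ = dualElt k i j := ⟨_, rfl⟩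
  obtain ⟨N, eN⟩ : ∃ N, N = redDisc i j k := ⟨_, rfl⟩
  rw [← eN] at ha hb hc hu hv hw
  rw [← eα] at ha hv hw mα tα
  rw [← eβ] at hb hu hw mβ tβ
  rw [← eγ] at hc hu hv mγ tγ
  have key : ∀ x ∈ codiff R, Matrix.trace x = 0 → N * x.det ∈ 𝒪[K] →
      (p : K)⁻¹ * (N * x.det) ∈ 𝒪[K] := by
    intro x hx htr hm
    refine (hp.inv_mem_or hm).resolve_left fun hu => hG ?_
    rw [eN] at hu
    exact h.isGorenstein hR hx htr hu.1 hu.2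
  have hsum : ∀ x ∈ codiff R, ∀ y ∈ codiff R, Matrix.trace x = 0 → Matrix.trace y = 0 →
      N * x.det ∈ 𝒪[K] → N * y.det ∈ 𝒪[K] → N * Matrix.trace (x * y) ∈ 𝒪[K] →
      (p : K)⁻¹ * (N * Matrix.trace (x * y)) ∈ 𝒪[K] := by
    intro x hx y hy tx ty dx dy dxy
    have e : N * (x + y).det = N * x.det + N * y.det - N * Matrix.trace (x * y) := by
      have e' : (x + y).det = x.det + y.det - Matrix.trace (x * y) +
          Matrix.trace x * Matrix.trace y := by
        simp only [Matrix.trace_fin_two, Matrix.det_fin_two, Matrix.mul_apply, Fin.sum_univ_two,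
          Matrix.add_apply]
        ring
      rw [e', tx]
      ring
    have hs := key (x + y) ((codiff R).add_mem hx hy) (by rw [Matrix.trace_add, tx, ty, add_zero])
      (e ▸ 𝒪[K].sub_mem (𝒪[K].add_mem dx dy) dxy)
    have := 𝒪[K].sub_mem (𝒪[K].add_mem (key x hx tx dx) (key y hy ty dy)) hs
    rw [e] at this
    convert this using 1
    ring
  exact h.exists_le_congruenceOrder hR.1 hp eα eβ eγ eN (key α mα tα ha) (key β mβ tβ hb)
    (key γ mγ tγ hc) (hsum β mβ γ mγ tβ tγ hb hc hu) (hsum γ mγ α mα tγ tα hc ha hv)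
    (hsum α mα β mβ tα tβ ha hb hw)

end Dual

end BassOrders

theorem theorem1p2 (K : Type*) [Field K] [ValuativeRel K] [TopologicalSpace K]
    [IsNonarchimedeanLocalField K] (H : Subalgebra 𝒪[K] (BassOrders.Mat K))
    (hH : BassOrders.IsOrder H) :
    BassOrders.IsBass H ↔
      BassOrders.IsLine (BassOrders.bruhatTitsTree K) (BassOrders.branch H) := by
  obtain ⟨p, hp⟩ := BassOrders.exists_isUnif (K := K)
  constructor
  · intro hB
    refine BassOrders.isLine_branch hp hH fun g hg => ?_
    exact BassOrders.not_isGorenstein_congruenceOrder hp g (hB _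
      (BassOrders.isFullOrder_congruenceOrder hp (BassOrders.isFullOrder_conjOrder g)) hg)
  · intro hL R hR hle
    by_contra hG
    obtain ⟨g, hg⟩ := BassOrders.exists_le_congruenceOrder_of_not_isGorenstein hR hG hp
    exact BassOrders.not_isLine_branch hp (hle.trans hg) hL
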